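/- Let $\Gamma$ be a locally compact (Hausdorff) amenable group with left Haar measure $|\cdot|$, let $X=(X,\mu)$ be a probability space and let $j\ge 0$. Let $\tau_1,\dots,\tau_j$ be (measurable) measure-preserving actions of $\Gamma$ on $X$ that commute pairwise in the sense that $$\tau_i(m)\tau_k(n)=\tau_k(n)\tau_i(m)\quad\text{whenever } m,n\in\Gamma,\ i\neq k,$$ and let $f_0,\dots,f_j\in L^\infty(X)$ be arbitrary bounded functions. Here identities between transformations of $X$ are understood $\mu$-almost everywhere, and measurability of an action $\tau$ means that for every $f\in L^2(X)$ the map $m\mapsto f\circ\tau(m)\in L^2(X)$ is almost everywhere strongly measurable on every compact subset of $\Gamma$. A Følner net in $\Gamma$ is a net $(F_\alpha)_{\alpha\in A}$ of compact subsets of $\Gamma$ of positive measure, indexed by a nonempty directed set $A$, such that for every compact set $K\subset\Gamma$ $$\lim_\alpha\ \sup_{l\in K}\frac{|lF_\alpha\,\Delta\,F_\alpha|}{|F_\alpha|}=0.$$ Then for every Følner net $(F_\alpha)_{\alpha\in A}$ in $\Gamma$ the limit $$\lim_\alpha\frac1{|F_\alpha|}\int_{m\in F_\alpha} f_0(x)\,f_1(\tau_1(m)x)\,f_2(\tau_1(m)\tau_2(m)x)\cdots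 f_j(\tau_1(m)\cdots\tau_j(m)x)$$ exists in $L^2(X)$ (the integral being that of an $L^2(X)$-valued function of $m$, integrable on each $F_\alpha$) and is independent of the Følner net $(F_\alpha)_{\alpha\in A}$. -/

import Mathlib

open MeasureTheory Filter Topology
open scoped ENNReal Pointwise symmDiff

/-- A Følner net in a locally compact group `Γ` with left Haar measure `ν`: a net of compact sets
of positive measure such that `sup_{l ∈ K} |l F_α Δ F_α| / |F_α| → 0` for every compact `K`.
The supremum and the quotient are taken in `[0, ∞]`. -/
structure IsFolnerNet {Γ A : Type*} [Group Γ] [TopologicalSpace Γ] [MeasurableSpace Γ]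
    [Preorder A] (ν : Measure Γ) (F : A → Set Γ) : Prop where
  isCompact : ∀ α, IsCompact (F α)
  measure_pos : ∀ α, 0 < ν (F α)
  tendsto_iSup : ∀ K : Set Γ, IsCompact K →
    Tendsto (fun α => ⨆ l ∈ K, ν ((l • F α) ∆ F α) / ν (F α)) atTop (𝓝 0)

/-- A (left) measure-preserving action `τ` of a locally compact group `Γ` with Haar measure `ν`
on `(X, μ)`. As usual for measure-preserving transformations, the identities of an action are
only required almost everywhere, for each fixed pair of group elements; so an action in the
strict sense is a special case. Measurability in the group variable is required in the form that
the orbit maps `m ↦ f ∘ τ m` into `L²` are a.e. strongly measurable on compact subsets of `Γ`.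
This is automatic if `Γ` is discrete, if `(m, x) ↦ τ m x` is measurable for the product
σ-algebra, or if the orbit maps are continuous. -/
structure IsMeasurePreservingAction {Γ X : Type*} [Group Γ] [TopologicalSpace Γ]
    [MeasurableSpace Γ] [MeasurableSpace X] (ν : Measure Γ) (μ : Measure X)
    (τ : Γ → X → X) : Prop where
  measurePreserving : ∀ m, MeasurePreserving (τ m) μ μ
  map_one : τ 1 =ᵐ[μ] id
  map_mul : ∀ m n, τ (m * n) =ᵐ[μ] τ m ∘ τ n
  aestronglyMeasurable : ∀ (f : Lp ℝ 2 μ) (K : Set Γ), IsCompact K →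
    AEStronglyMeasurable (fun m => Lp.compMeasurePreserving (τ m) (measurePreserving m) f)
      (ν.restrict K)

/-- `partialComp T i` is the composition of the first `i` of the maps `T`: writing the maps as
`T₁, …, T_j`, it is `T₁ ∘ ⋯ ∘ T_i`, and the identity for `i = 0`. -/
def partialComp {X : Type*} {j : ℕ} (T : Fin j → X → X) : Fin (j + 1) → X → X :=
  Fin.induction id (fun k g => g ∘ T k)

theorem measurePreserving_partialComp {X : Type*} [MeasurableSpace X] {μ : Measure X} {j : ℕ}
    {T : Fin j → X → X} (hT : ∀ k, MeasurePreserving (T k) μ μ) (i : Fin (j + 1)) :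
    MeasurePreserving (partialComp T i) μ μ := by
  induction i using Fin.induction with
  | zero => exact MeasurePreserving.id μ
  | succ k ih => exact ih.comp (hT k)

theorem memLp_two_prod_partialComp {X 𝕜 : Type*} [RCLike 𝕜] [MeasurableSpace X]
    {μ : Measure X} [IsFiniteMeasure μ] {j : ℕ}
    {T : Fin j → X → X} (hT : ∀ k, MeasurePreserving (T k) μ μ)
    {f : Fin (j + 1) → X → 𝕜} (hf : ∀ i, MemLp (f i) ∞ μ) :
    MemLp (fun x => ∏ i, f i (partialComp T i x)) 2 μ := by
  have h : MemLp (fun x => ∏ i, f i (partialComp T i x)) (∑ _i : Fin (j + 1), (∞ : ℝ≥0∞)⁻¹)⁻¹ μ :=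
    MemLp.prod' fun i _ => (hf i).comp_measurePreserving (measurePreserving_partialComp hT i)
  exact h.mono_exponent (by simp)

/-- The element `x ↦ f₀(x) f₁(τ₁(m) x) ⋯ f_j(τ₁(m) ⋯ τ_j(m) x)` of `L²(X)`. The actions
`τ₁, …, τ_j` are indexed by `Fin j`, the functions `f₀, …, f_j` by `Fin (j + 1)`. -/
noncomputable def multipleProduct {Γ X 𝕜 : Type*} [RCLike 𝕜] [MeasurableSpace X]
    {μ : Measure X} [IsFiniteMeasure μ] {j : ℕ} {τ : Fin j → Γ → X → X}
    (hτ : ∀ k m, MeasurePreserving (τ k m) μ μ) {f : Fin (j + 1) → X → 𝕜}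
    (hf : ∀ i, MemLp (f i) ∞ μ) (m : Γ) : Lp 𝕜 2 μ :=
  (memLp_two_prod_partialComp (fun k => hτ k m) hf).toLp
    (fun x => ∏ i, f i (partialComp (fun k => τ k m) i x))

/-- The average `|F|⁻¹ ∫_{m ∈ F} f₀(x) f₁(τ₁(m) x) ⋯ f_j(τ₁(m) ⋯ τ_j(m) x) dν(m)`,
an integral of an `L²(X)`-valued function. -/
noncomputable def multipleAverage {Γ X 𝕜 : Type*} [RCLike 𝕜] [MeasurableSpace Γ]
    [MeasurableSpace X] (ν : Measure Γ)
    {μ : Measure X} [IsFiniteMeasure μ] {j : ℕ} {τ : Fin j → Γ → X → X}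
    (hτ : ∀ k m, MeasurePreserving (τ k m) μ μ) {f : Fin (j + 1) → X → 𝕜}
    (hf : ∀ i, MemLp (f i) ∞ μ) (F : Set Γ) : Lp 𝕜 2 μ :=
  (ν.real F)⁻¹ • ∫ m in F, multipleProduct hτ hf m ∂ν

/-! ### Bounded operators on a Hilbert space: convergence from the range of `B† B`. -/

section Hilbert

open scoped InnerProductSpace

/-! Let `U_i(m)` be the operator of composition with `τ₁(m) ⋯ τ_i(m)`. The factor `f₀` is a fixed
multiplier, so the task is to show that the averages of `∏ U_i(l) f_i` are Cauchy along Følner sets.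
This goes by induction on the number of factors. With all functions but the last one fixed, the
average is an operator applied to that last function: `B_F v` is the average over `l ∈ F` of
`∏_{i<k} U_i(l) f_i · U_k(l) v`.

The vectors on which a uniformly bounded family `B_F` is Cauchy form a closed subspace `G`. Suppose
`G` contains all weak ultrafilter limits of `B_F† B_F v`. If `y ⟂ G`, then `‖B_F y‖² = ⟪B_F† B_F y,
y⟫ → 0`, hence `y ∈ G` and `y = 0`; so `G` is everything (`cauchy_of_cauchy_on_adjoint_range`). It
remains to understand `B_E B_F† w` with `w = B_F v` and with `F` almost invariant under `E`.

The substitution `m ↦ l m` and the commutation relations show that `B_E B_F† w` is close to the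
average over `m ∈ F` of `U_k(m)⁻¹ w` times the `E`-average of `∏_{i<k} U_i(l) (f_i · U_k(m)⁻¹ U_i(m)
f_i*)` (`norm_opAvg_dualAvg_sub_le`). This inner average has one factor fewer. The relations hold
because `U_k(m)⁻¹ U_i(m)` only involves the actions with index above `i`, and these commute with
`U_i(l)`.

The new functions depend on `m ∈ F`, and `F` moves along the net, so the induction needs uniformity
in the functions. `MeanCauchy` provides it in quadratic mean: the functions form an arbitrary
bounded family over a set `P` carrying a finitely additive mean. The inductive step replaces `P` by
`P × Γ`, with the ultrafilter limit of averages over `F` followed by the mean over `P`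
(`exists_iterated_mean`). The Hilbert space is the completion of the bounded families over `P` in
the seminorm of the mean. -/

theorem exists_tendsto_ultrafilter_of_abs_le {ι : Type*} (ω : Ultrafilter ι) {x : ι → ℝ} {C : ℝ}
    (hx : ∀ i, |x i| ≤ C) : ∃ c, |c| ≤ C ∧ Tendsto x ω (𝓝 c) := by
  obtain ⟨c, hc, hl⟩ := isCompact_iff_ultrafilter_le_nhds.1 (isCompact_Icc (a := -C) (b := C))
    (ω.map x) (le_principal_iff.2 (Eventually.of_forall (f := (ω : Filter ι))
      fun i => abs_le.1 (hx i)))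
  exact ⟨c, abs_le.2 hc, hl⟩

/-- Bounded nets in a Hilbert space converge weakly along ultrafilters. -/
theorem exists_weak_limit {ι Y : Type*} [NormedAddCommGroup Y] [InnerProductSpace ℝ Y]
    [CompleteSpace Y] (ω : Ultrafilter ι) {s : ι → Y} {C : ℝ} (hs : ∀ i, ‖s i‖ ≤ C) :
    ∃ σ : Y, ∀ y, Tendsto (fun i => ⟪s i, y⟫_ℝ) ω (𝓝 ⟪σ, y⟫_ℝ) := by
  have hlim : ∀ y, ∃ c, |c| ≤ C * ‖y‖ ∧ Tendsto (fun i => ⟪s i, y⟫_ℝ) ω (𝓝 c) := by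
    intro y
    exact exists_tendsto_ultrafilter_of_abs_le ω fun i =>
      (abs_real_inner_le_norm (s i) y).trans (by gcongr; exact hs i)
  choose c hcb hc using hlim
  let L : Y →ₗ[ℝ] ℝ :=
    { toFun := c
      map_add' := fun y z => tendsto_nhds_unique (hc (y + z)) <| by
        simpa only [inner_add_right] using (hc y).add (hc z)
      map_smul' := fun r y => tendsto_nhds_unique (hc (r • y)) <| by
        simpa [inner_smul_right] using (hc y).const_mul r }
  let L' : StrongDual ℝ Y := L.mkContinuous C hcb
  refine ⟨(InnerProductSpace.toDual ℝ Y).symm L', fun y => ?_⟩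
  rw [InnerProductSpace.toDual_symm_apply]
  exact hc y

/-- A uniformly bounded family of operators converges strongly if it is Cauchy, in the weak sense
made precise by the hypothesis, on the vectors `(B F)† (B F) v` with `v` in a dense set. -/
theorem cauchy_of_cauchy_on_adjoint_range {ι Y : Type*} [NormedAddCommGroup Y]
    [InnerProductSpace ℝ Y] [CompleteSpace Y] (Φ : Filter ι) (B : ι → Y →L[ℝ] Y) {C : ℝ}
    (hB : ∀ F, ‖B F‖ ≤ C) {D : Set Y} (hD : Dense D)
    (h : ∀ v ∈ D, ∀ ω : Ultrafilter ι, (ω : Filter ι) ≤ Φ → ∀ ε > 0, ∀ᶠ q in Φ ×ˢ Φ,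
      ∀ᶠ F in (ω : Filter ι),
        ‖(B q.1 - B q.2) (ContinuousLinearMap.adjoint (B F) (B F v))‖ ≤ ε) :
    ∀ y, ∀ ε > 0, ∀ᶠ q in Φ ×ˢ Φ, ‖B q.1 y - B q.2 y‖ ≤ ε := by
  -- An index is needed to know that `C` is nonnegative.
  by_cases hC0 : ∀ F : ι, False
  · intro y ε _
    exact Eventually.of_forall fun q => (hC0 q.1).elim
  push Not at hC0
  obtain ⟨F₀, -⟩ := hC0
  have hC : 0 ≤ C := (norm_nonneg _).trans (hB F₀)
  have hBv : ∀ F y, ‖B F y‖ ≤ C * ‖y‖ := fun F y => (B F).le_of_opNorm_le (hB F) y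
  let G : Submodule ℝ Y :=
    { carrier := {y | ∀ ε > 0, ∀ᶠ q in Φ ×ˢ Φ, ‖B q.1 y - B q.2 y‖ ≤ ε}
      zero_mem' := fun ε hε => by simp [hε.le]
      add_mem' := fun {y z} hy hz ε hε => by
        filter_upwards [hy (ε / 2) (by positivity), hz (ε / 2) (by positivity)] with q h1 h2
        have : B q.1 (y + z) - B q.2 (y + z) = (B q.1 y - B q.2 y) + (B q.1 z - B q.2 z) := by
          simp only [map_add]; abel
        rw [this]
        exact (norm_add_le _ _).trans (by linarith)
      smul_mem' := fun r y hy ε hε => by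
        filter_upwards [hy (ε / (|r| + 1)) (by positivity)] with q h1
        rw [map_smul, map_smul, ← smul_sub, norm_smul, Real.norm_eq_abs]
        calc |r| * ‖B q.1 y - B q.2 y‖ ≤ (|r| + 1) * (ε / (|r| + 1)) := by gcongr; linarith
          _ = ε := by field_simp }
  have hGclosed : IsClosed (G : Set Y) := by
    refine isClosed_of_closure_subset fun y hy ε hε => ?_
    obtain ⟨z, hz, hyz⟩ := Metric.mem_closure_iff.1 hy (ε / (4 * (C + 1))) (by positivity)
    rw [dist_eq_norm] at hyz
    filter_upwards [hz (ε / 2) (by positivity)] with q hq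
    have h3 : C * ‖y - z‖ ≤ ε / 4 := by
      calc C * ‖y - z‖ ≤ (C + 1) * (ε / (4 * (C + 1))) := by gcongr; linarith
        _ = ε / 4 := by field_simp
    have : B q.1 y - B q.2 y = B q.1 (y - z) + (B q.1 z - B q.2 z) - B q.2 (y - z) := by
      simp only [map_sub]; abel
    rw [this]
    have h1 := norm_sub_le (B q.1 (y - z) + (B q.1 z - B q.2 z)) (B q.2 (y - z))
    have h2 := norm_add_le (B q.1 (y - z)) (B q.1 z - B q.2 z)
    have h4 := hBv q.1 (y - z)
    have h5 := hBv q.2 (y - z)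
    linarith
  have horth : Gᗮ = ⊥ := by
    rw [eq_bot_iff]
    intro y hy
    have hBy : Tendsto (fun F => ‖B F y‖) Φ (𝓝 0) := by
      rw [tendsto_iff_ultrafilter]
      intro ω hω
      rw [Metric.tendsto_nhds]
      intro ε hε
      -- The hypothesis covers only vectors of `D`, so `y` is replaced by a nearby `v`; the radius
      -- makes the error term `e2` at most `ε² / 4`.
      obtain ⟨v, hvb, hvD⟩ := Metric.dense_iff.1 hD y
        (ε ^ 2 / (4 * (C ^ 2 * ‖y‖ + 1))) (by positivity)
      rw [Metric.mem_ball, dist_comm, dist_eq_norm] at hvb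
      set s : ι → Y := fun F => ContinuousLinearMap.adjoint (B F) (B F v) with hs
      have hsb : ∀ F, ‖s F‖ ≤ C * (C * ‖v‖) := fun F => by
        refine (ContinuousLinearMap.le_of_opNorm_le _ (c := C) ?_ _).trans ?_
        · rw [LinearIsometryEquiv.norm_map]; exact hB F
        · gcongr; exact hBv F v
      obtain ⟨σ, hσ⟩ := exists_weak_limit ω hsb
      have hσG : σ ∈ G := by
        intro ε hε
        filter_upwards [h v hvD ω hω ε hε] with q hq
        rw [← sub_apply]
        set T := B q.1 - B q.2
        -- Weak lower semicontinuity of the norm: testing the weak limit against `T† T σ` transfers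
        -- the bound on `‖T (s F)‖` to `‖T σ‖`.
        have hlim := hσ (ContinuousLinearMap.adjoint T (T σ))
        simp only [ContinuousLinearMap.adjoint_inner_right] at hlim
        have hle : ⟪T σ, T σ⟫_ℝ ≤ ε * ‖T σ‖ := by
          refine le_of_tendsto hlim ?_
          filter_upwards [hq] with F hF
          exact (real_inner_le_norm _ _).trans (by gcongr)
        rw [real_inner_self_eq_norm_sq] at hle
        by_contra! hlt
        have : 0 < ‖T σ‖ := hε.trans hlt
        nlinarith
      have hzero : ⟪σ, y⟫_ℝ = 0 := (Submodule.mem_orthogonal G y).1 hy σ hσG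
      have hlim := hσ y
      rw [hzero] at hlim
      filter_upwards [(Metric.tendsto_nhds.1 hlim) (ε ^ 2 / 2) (by positivity)] with F hF
      simp only [dist_zero_right, norm_norm]
      rw [dist_zero_right, Real.norm_eq_abs] at hF
      have e1 : ‖B F y‖ ^ 2 = ⟪s F, y⟫_ℝ + ⟪B F y, B F (y - v)⟫_ℝ := by
        rw [hs, ContinuousLinearMap.adjoint_inner_left, real_inner_comm, ← inner_add_right,
          ← map_add, add_sub_cancel, real_inner_self_eq_norm_sq]
      have e2 : ⟪B F y, B F (y - v)⟫_ℝ ≤ ε ^ 2 / 4 := by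
        calc ⟪B F y, B F (y - v)⟫_ℝ ≤ ‖B F y‖ * ‖B F (y - v)‖ := real_inner_le_norm _ _
          _ ≤ (C * ‖y‖) * (C * ‖y - v‖) := by gcongr <;> exact hBv F _
          _ = (C ^ 2 * ‖y‖) * ‖y - v‖ := by ring
          _ ≤ (C ^ 2 * ‖y‖ + 1) * (ε ^ 2 / (4 * (C ^ 2 * ‖y‖ + 1))) := by
            gcongr; linarith
          _ = ε ^ 2 / 4 := by field_simp
      have e3 := (le_abs_self _).trans_lt hF
      exact lt_of_pow_lt_pow_left₀ 2 hε.le (by nlinarith [sq_pos_of_pos hε])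
    have hyG : y ∈ G := by
      intro ε hε
      have h1 := (Metric.tendsto_nhds.1 hBy) (ε / 2) (by positivity)
      filter_upwards [h1.prod_mk h1] with q hq
      simp only [dist_zero_right, norm_norm] at hq
      exact (norm_sub_le _ _).trans (by linarith [hq.1, hq.2])
    exact inner_self_eq_zero.1 ((Submodule.mem_orthogonal G y).1 hy y hyG)
  have hG : G = ⊤ := by
    have : CompleteSpace G := hGclosed.completeSpace_coe
    exact (Submodule.orthogonal_eq_bot_iff).1 horth
  intro y
  have : y ∈ G := hG ▸ Submodule.mem_top
  exact this

open UniformSpace in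
/-- A version of `cauchy_of_cauchy_on_adjoint_range` for incomplete spaces. -/
theorem cauchy_of_cauchy_on_formal_adjoint_range {ι V : Type*} [SeminormedAddCommGroup V]
    [InnerProductSpace ℝ V] (Φ : Filter ι) (B : ι → V →ₗ[ℝ] V) (B' : ι → V → V) {C : ℝ}
    (hB : ∀ F v, ‖B F v‖ ≤ C * ‖v‖) (hB' : ∀ F v w, ⟪B F v, w⟫_ℝ = ⟪v, B' F w⟫_ℝ)
    (h : ∀ v, ∀ ω : Ultrafilter ι, (ω : Filter ι) ≤ Φ → ∀ ε > 0, ∀ᶠ q in Φ ×ˢ Φ,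
      ∀ᶠ F in (ω : Filter ι),
        ‖B q.1 (B' F (B F v)) - B q.2 (B' F (B F v))‖ ≤ ε) :
    ∀ v, ∀ ε > 0, ∀ᶠ q in Φ ×ˢ Φ, ‖B q.1 v - B q.2 v‖ ≤ ε := by
  let T : ι → Completion V →L[ℝ] Completion V := fun F =>
    ((B F).mkContinuous C (hB F)).completion
  have hT : ∀ F (v : V), T F (v : Completion V) = (B F v : V) := fun F v =>
    ContinuousLinearMap.completion_apply_coe _ v
  have hTb : ∀ F, ‖T F‖ ≤ max C 0 := fun F => by
    refine ContinuousLinearMap.opNorm_le_bound _ (le_max_right _ _) fun y => ?_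
    induction y using Completion.induction_on with
    | hp => exact isClosed_le (by fun_prop) (by fun_prop)
    | ih v =>
      rw [hT, Completion.norm_coe, Completion.norm_coe]
      exact (hB F v).trans (by gcongr; exact le_max_left _ _)
  have hT' : ∀ F (v : V), ContinuousLinearMap.adjoint (T F) (v : Completion V) = (B' F v : V) := by
    intro F v
    refine ext_inner_left ℝ fun y => ?_
    induction y using Completion.induction_on with
    | hp => exact isClosed_eq (by fun_prop) (by fun_prop)
    | ih w =>
      rw [ContinuousLinearMap.adjoint_inner_right, hT, Completion.inner_coe,
        Completion.inner_coe, hB']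
  -- The hypothesis is available only on the image of `V` in its completion, which is dense.
  have key := cauchy_of_cauchy_on_adjoint_range Φ T hTb
    (D := Set.range ((↑) : V → Completion V)) Completion.denseRange_coe (by
      rintro _ ⟨v, rfl⟩ ω hω ε hε
      filter_upwards [h v ω hω ε hε] with q hq
      filter_upwards [hq] with F hF
      rw [hT, hT', sub_apply, hT, hT, ← Completion.coe_sub,
        Completion.norm_coe]
      exact hF)
  intro v ε hε
  filter_upwards [key v ε hε] with q hq
  rwa [hT, hT, ← Completion.coe_sub, Completion.norm_coe] at hq

end Hilbert

/-! ### Finitely additive means. -/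

section Mean

/-- A finitely additive probability-like mean: a linear functional that is nonnegative on
bounded nonnegative functions. -/
def IsMean {P : Type*} (m : (P → ℝ) →ₗ[ℝ] ℝ) : Prop :=
  ∀ f : P → ℝ, (∃ C, ∀ p, f p ≤ C) → (∀ p, 0 ≤ f p) → 0 ≤ m f

theorem IsMean.mono {P : Type*} {m : (P → ℝ) →ₗ[ℝ] ℝ} (hm : IsMean m) {f g : P → ℝ} {C : ℝ}
    (hf : ∀ p, -C ≤ f p) (hg : ∀ p, g p ≤ C) (hfg : ∀ p, f p ≤ g p) : m f ≤ m g := by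
  have := hm (g - f) ⟨2 * C, fun p => by simp only [Pi.sub_apply]; linarith [hf p, hg p]⟩
    fun p => sub_nonneg.2 (hfg p)
  rwa [map_sub, sub_nonneg] at this

theorem IsMean.abs_le {P : Type*} {m : (P → ℝ) →ₗ[ℝ] ℝ} (hm : IsMean m) {f : P → ℝ} {C : ℝ}
    (hf : ∀ p, |f p| ≤ C) : |m f| ≤ m fun _ => C := by
  rw [_root_.abs_le, ← map_neg]
  exact ⟨hm.mono (C := C) (fun _ => le_rfl) (fun p => (_root_.abs_le.1 (hf p)).2)
      (fun p => (_root_.abs_le.1 (hf p)).1),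
    hm.mono (C := C) (fun p => (_root_.abs_le.1 (hf p)).1) (fun _ => le_rfl)
      (fun p => (_root_.abs_le.1 (hf p)).2)⟩

theorem isMean_eval {P : Type*} (p : P) : IsMean (LinearMap.proj p : (P → ℝ) →ₗ[ℝ] ℝ) :=
  fun _ _ h => h p

/-- A linear functional on all real functions extending the limit along a filter. -/
theorem exists_linear_limit {ι : Type*} (ω : Filter ι) [NeBot ω] :
    ∃ L : (ι → ℝ) →ₗ[ℝ] ℝ, ∀ f c, Tendsto f ω (𝓝 c) → L f = c := by
  let S : Submodule ℝ (ι → ℝ) :=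
    { carrier := {f | ∃ c, Tendsto f ω (𝓝 c)}
      zero_mem' := ⟨0, tendsto_const_nhds⟩
      add_mem' := fun ⟨c, hc⟩ ⟨d, hd⟩ => ⟨c + d, hc.add hd⟩
      smul_mem' := fun r f ⟨c, hc⟩ => ⟨r • c, hc.const_smul r⟩ }
  let l : S →ₗ[ℝ] ℝ :=
    { toFun := fun f => f.2.choose
      map_add' := fun f g => tendsto_nhds_unique (f + g).2.choose_spec
        (f.2.choose_spec.add g.2.choose_spec)
      map_smul' := fun r f => tendsto_nhds_unique (r • f).2.choose_spec
        (f.2.choose_spec.const_smul r) }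
  obtain ⟨L, hL⟩ := l.exists_extend
  refine ⟨L, fun f c hc => ?_⟩
  have : L f = l ⟨f, c, hc⟩ := by rw [← hL]; rfl
  rw [this]
  exact tendsto_nhds_unique (Exists.choose_spec (⟨c, hc⟩ : ∃ c, Tendsto f ω (𝓝 c))) hc

/-- A mean on all functions that extends the expectation of bounded integrable functions. -/
theorem exists_mean_extending_integral {Ω : Type*} [MeasurableSpace Ω] (π : Measure Ω)
    [IsProbabilityMeasure π] :
    ∃ m : (Ω → ℝ) →ₗ[ℝ] ℝ, IsMean m ∧
      ∀ f, (∃ C, ∀ x, |f x| ≤ C) → Integrable f π → m f = ∫ x, f x ∂π := by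
  let E : Submodule ℝ (Ω → ℝ) :=
    { carrier := {f | ∃ C, ∀ x, |f x| ≤ C}
      zero_mem' := ⟨0, fun x => by simp⟩
      add_mem' := fun ⟨C, hC⟩ ⟨D, hD⟩ => ⟨C + D, fun x => (abs_add_le _ _).trans
        (add_le_add (hC x) (hD x))⟩
      smul_mem' := fun r f ⟨C, hC⟩ => ⟨|r| * C, fun x => by
        simp only [Pi.smul_apply, smul_eq_mul, abs_mul]; gcongr; exact hC x⟩ }
  let I : Submodule ℝ E :=
    { carrier := {f | Integrable f.1 π}
      zero_mem' := integrable_zero _ _ _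
      add_mem' := fun hf hg => hf.add hg
      smul_mem' := fun r f hf => hf.smul r }
  let φ : E →ₗ.[ℝ] ℝ :=
    { domain := I
      toFun :=
        { toFun := fun f => ∫ x, f.1.1 x ∂π
          map_add' := fun f g => integral_add f.2 g.2
          map_smul' := fun r f => integral_smul r f.1.1 } }
  let s : PointedCone ℝ E :=
    { carrier := {f | ∀ x, 0 ≤ f.1 x}
      zero_mem' := fun x => le_rfl
      add_mem' := fun hf hg x => add_nonneg (hf x) (hg x)
      smul_mem' := fun r f hf x => mul_nonneg r.2 (hf x) }
  -- The extension theorem requires every bounded function to become nonnegative after adding an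
  -- integrable one; a constant suffices.
  obtain ⟨g, hg, hgs⟩ := riesz_extension s φ (fun f hf => integral_nonneg hf) (by
    rintro ⟨y, C, hC⟩
    refine ⟨⟨⟨fun _ => C, |C|, fun _ => le_rfl⟩, integrable_const C⟩, fun x => ?_⟩
    have := neg_le_of_abs_le (hC x)
    change 0 ≤ C + y x
    linarith)
  -- The values on unbounded functions are arbitrary, which is harmless as positivity is only asked
  -- on bounded ones.
  obtain ⟨m, hm⟩ := g.exists_extend
  have hmg : ∀ f : E, m f.1 = g f := fun f => by rw [← hm]; rfl
  refine ⟨m, fun f ⟨C, hC⟩ hf => ?_, fun f hb hi => ?_⟩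
  · have hE : f ∈ E := ⟨C, fun x => by rw [abs_of_nonneg (hf x)]; exact hC x⟩
    rw [hmg ⟨f, hE⟩]
    exact hgs _ hf
  · rw [hmg ⟨f, hb⟩]
    exact hg ⟨⟨f, hb⟩, hi⟩

end Mean

/-! ### Integrals of continuous functions against measures carried by compact sets. -/

section CompactAverages

/-- The measure gives no mass to the complement of some compact set. -/
def ConcentratedOnCompact {Z : Type*} [TopologicalSpace Z] [MeasurableSpace Z]
    (π : Measure Z) : Prop :=
  ∃ K : Set Z, IsCompact K ∧ π Kᶜ = 0

set_option linter.unusedSectionVars false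

variable {Z W E : Type*} [TopologicalSpace Z] [T2Space Z] [MeasurableSpace Z] [BorelSpace Z]
  [NormedAddCommGroup E] [NormedSpace ℝ E] {π : Measure Z} [IsProbabilityMeasure π]

theorem ConcentratedOnCompact.integrable (hπ : ConcentratedOnCompact π) {g : Z → E}
    (hg : Continuous g) : Integrable g π := by
  obtain ⟨K, hK, h0⟩ := hπ
  have h := hg.continuousOn.integrableOn_compact (μ := π) hK
  rwa [IntegrableOn, Measure.restrict_eq_self_of_ae_mem (mem_ae_iff.2 h0)] at h

theorem norm_sq_integral_le (hπ : ConcentratedOnCompact π) {g : Z → E} (hg : Continuous g) :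
    ‖∫ x, g x ∂π‖ ^ 2 ≤ ∫ x, ‖g x‖ ^ 2 ∂π := by
  have h1 : ‖∫ x, g x ∂π‖ ≤ ∫ x, ‖g x‖ ∂π := norm_integral_le_integral_norm _
  have h2 : (∫ x, ‖g x‖ ∂π) ^ 2 ≤ ∫ x, ‖g x‖ ^ 2 ∂π :=
    (convexOn_pow 2).map_integral_le (by fun_prop) isClosed_Ici
      (Eventually.of_forall fun x => norm_nonneg (g x)) (hπ.integrable hg.norm)
      (hπ.integrable (by fun_prop))
  exact (by gcongr : ‖∫ x, g x ∂π‖ ^ 2 ≤ (∫ x, ‖g x‖ ∂π) ^ 2).trans h2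

/-- Without countability assumptions on `W`, dominated convergence does not apply. The tube lemma
instead gives closeness uniformly on the compact carrier. -/
theorem ConcentratedOnCompact.continuous_integral [TopologicalSpace W]
    (hπ : ConcentratedOnCompact π) {f : W → Z → E} (hf : Continuous f.uncurry) :
    Continuous fun w => ∫ x, f w x ∂π := by
  obtain ⟨K, hK, h0⟩ := id hπ
  rw [continuous_iff_continuousAt]
  intro w₀
  rw [ContinuousAt, Metric.tendsto_nhds]
  intro ε hε
  have hopen : IsOpen {q : W × Z | dist (f q.1 q.2) (f w₀ q.2) < ε / 2} := by
    refine isOpen_lt ?_ continuous_const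
    exact hf.dist (hf.comp (by fun_prop : Continuous fun q : W × Z => (w₀, q.2)))
  obtain ⟨u, v, hu, -, hwu, hKv, huv⟩ := generalized_tube_lemma
    (isCompact_singleton (x := w₀)) hK hopen (by
      rintro ⟨w, x⟩ ⟨hw, -⟩
      rw [Set.mem_singleton_iff] at hw
      simp only at hw
      simp [hw, hε])
  filter_upwards [hu.mem_nhds (hwu rfl)] with w hw
  have hcont : ∀ w, Continuous (f w) := fun w => hf.comp (by fun_prop : Continuous fun z => (w, z))
  rw [dist_eq_norm, ← integral_sub (hπ.integrable (hcont _)) (hπ.integrable (hcont _))]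
  have hae : ∀ᵐ x ∂π, ‖f w x - f w₀ x‖ ≤ ε / 2 := by
    filter_upwards [show K ∈ ae π from mem_ae_iff.2 h0] with x hx
    rw [← dist_eq_norm]
    exact (huv (Set.mk_mem_prod hw (hKv hx)) : _ < _).le
  have := norm_integral_le_of_norm_le_const hae
  simp only [measureReal_def, measure_univ, ENNReal.toReal_one, mul_one] at this
  linarith

/-- The integrand need not be measurable for the product σ-algebra. Cutoffs equal to `1` on the
carriers make it continuous with compact support, where the order of integration can be exchanged.
-/
theorem ConcentratedOnCompact.integral_swap [LocallyCompactSpace Z]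
    [TopologicalSpace W] [T2Space W] [LocallyCompactSpace W] [MeasurableSpace W] [BorelSpace W]
    {ρ : Measure W} [IsProbabilityMeasure ρ]
    (hπ : ConcentratedOnCompact π) (hρ : ConcentratedOnCompact ρ) {f : Z → W → E}
    (hf : Continuous f.uncurry) :
    ∫ x, ∫ y, f x y ∂ρ ∂π = ∫ y, ∫ x, f x y ∂π ∂ρ := by
  obtain ⟨K, hK, h0⟩ := hπ
  obtain ⟨L, hL, h1⟩ := hρ
  obtain ⟨χ, hχ1, -, hχc, -⟩ :=
    exists_continuous_one_zero_of_isCompact hK isClosed_empty (Set.disjoint_empty K)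
  obtain ⟨θ, hθ1, -, hθc, -⟩ :=
    exists_continuous_one_zero_of_isCompact hL isClosed_empty (Set.disjoint_empty L)
  have hKae : ∀ᵐ x ∂π, χ x = 1 := by
    filter_upwards [show K ∈ ae π from mem_ae_iff.2 h0] with x hx using hχ1 hx
  have hLae : ∀ᵐ y ∂ρ, θ y = 1 := by
    filter_upwards [show L ∈ ae ρ from mem_ae_iff.2 h1] with y hy using hθ1 hy
  have hcomp : HasCompactSupport (Function.uncurry fun x y => (χ x * θ y) • f x y) := by
    refine HasCompactSupport.intro (hχc.prod hθc) ?_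
    rintro ⟨x, y⟩ hxy
    rw [Set.mem_prod, not_and_or] at hxy
    rcases hxy with h | h
    · simp [image_eq_zero_of_notMem_tsupport h]
    · simp [image_eq_zero_of_notMem_tsupport h]
  have hcont : Continuous (Function.uncurry fun x y => (χ x * θ y) • f x y) :=
    (by fun_prop : Continuous fun q : Z × W => χ q.1 * θ q.2).smul hf
  have key := integral_integral_swap_of_hasCompactSupport hcont hcomp (μ := π) (ν := ρ)
  have e1 : ∫ x, ∫ y, f x y ∂ρ ∂π = ∫ x, ∫ y, (χ x * θ y) • f x y ∂ρ ∂π := by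
    refine integral_congr_ae ?_
    filter_upwards [hKae] with x hx
    refine integral_congr_ae ?_
    filter_upwards [hLae] with y hy
    simp [hx, hy]
  have e2 : ∫ y, ∫ x, f x y ∂π ∂ρ = ∫ y, ∫ x, (χ x * θ y) • f x y ∂π ∂ρ := by
    refine integral_congr_ae ?_
    filter_upwards [hLae] with y hy
    refine integral_congr_ae ?_
    filter_upwards [hKae] with x hx
    simp [hx, hy]
  rw [e1, key, e2]

end CompactAverages

/-! ### The Følner filter and almost invariance of averages. -/

section Folner

set_option linter.unusedSectionVars false

variable {Γ E : Type*} [Group Γ] [TopologicalSpace Γ] [IsTopologicalGroup Γ] [T2Space Γ]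
  [MeasurableSpace Γ] [BorelSpace Γ] (ν : Measure Γ) [ν.IsHaarMeasure]
  [NormedAddCommGroup E] [NormedSpace ℝ E]

/-- Compact sets of positive Haar measure. -/
structure AveragingSet where
  /-- The underlying set. -/
  carrier : Set Γ
  isCompact : IsCompact carrier
  measure_pos : 0 < ν carrier

variable {ν}

/-- The normalized restriction of the Haar measure. -/
noncomputable def AveragingSet.measure (F : AveragingSet ν) : Measure Γ :=
  ProbabilityTheory.cond ν F.carrier

theorem AveragingSet.measure_ne_top (F : AveragingSet ν) : ν F.carrier ≠ ∞ := F.isCompact.measure_lt_top.ne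

instance (F : AveragingSet ν) : IsProbabilityMeasure F.measure :=
  ProbabilityTheory.cond_isProbabilityMeasure_of_finite F.measure_pos.ne' F.measure_ne_top

theorem AveragingSet.ae_mem (F : AveragingSet ν) : ∀ᵐ m ∂F.measure, m ∈ F.carrier :=
  ProbabilityTheory.ae_cond_mem F.isCompact.measurableSet

theorem AveragingSet.concentrated (F : AveragingSet ν) : ConcentratedOnCompact F.measure :=
  ⟨F.carrier, F.isCompact, by
    rw [AveragingSet.measure, ProbabilityTheory.cond_apply F.isCompact.measurableSet]; simp⟩

theorem AveragingSet.integral_eq (F : AveragingSet ν) (g : Γ → E) :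
    ∫ m, g m ∂F.measure = (ν.real F.carrier)⁻¹ • ∫ m in F.carrier, g m ∂ν := by
  rw [AveragingSet.measure, ProbabilityTheory.cond, integral_smul_measure, ENNReal.toReal_inv]
  rfl

variable (ν) in
/-- The filter of Følner sets: it is generated by the sets of `(K, ε)`-invariant sets. -/
noncomputable def folnerFilter : Filter (AveragingSet ν) :=
  ⨅ K : {K : Set Γ // IsCompact K},
    comap (fun F : AveragingSet ν => ⨆ l ∈ K.1, ν ((l • F.carrier) ∆ F.carrier) / ν F.carrier) (𝓝 0)

/-- All Følner nets refine a single filter, so a limit along that filter serves every net at once.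
-/
theorem IsFolnerNet.tendsto_folnerFilter {A : Type*} [Preorder A] {F : A → Set Γ}
    (hF : IsFolnerNet ν F) :
    Tendsto (fun α => (⟨F α, hF.isCompact α, hF.measure_pos α⟩ : AveragingSet ν)) atTop
      (folnerFilter ν) :=
  tendsto_iInf.2 fun K => tendsto_comap_iff.2 (hF.tendsto_iSup K.1 K.2)

theorem eventually_folnerFilter {K : Set Γ} (hK : IsCompact K) {ε : ℝ≥0∞} (hε : 0 < ε) :
    ∀ᶠ F in folnerFilter ν, ∀ l ∈ K, ν ((l • F.carrier) ∆ F.carrier) / ν F.carrier ≤ ε := by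
  have h : Tendsto (fun F : AveragingSet ν => ⨆ l ∈ K, ν ((l • F.carrier) ∆ F.carrier) / ν F.carrier)
      (folnerFilter ν) (𝓝 0) :=
    tendsto_iff_comap.2 (iInf_le _ (⟨K, hK⟩ : {K : Set Γ // IsCompact K}))
  filter_upwards [h.eventually (gt_mem_nhds hε)] with F hF l hl
  exact (le_iSup₂ (f := fun l _ => ν ((l • F.carrier) ∆ F.carrier) / ν F.carrier) l hl).trans hF.le

theorem AveragingSet.norm_integral_translate_sub_le (F : AveragingSet ν) {g : Γ → E}
    (hg : Continuous g) {C : ℝ} (hC : ∀ m, ‖g m‖ ≤ C) {l : Γ} {ε : ℝ} (hε : 0 ≤ ε)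
    (hl : ν ((l • F.carrier) ∆ F.carrier) / ν F.carrier ≤ ENNReal.ofReal ε) :
    ‖∫ m, g (l⁻¹ * m) ∂F.measure - ∫ m, g m ∂F.measure‖ ≤ C * ε := by
  have hFm : MeasurableSet F.carrier := F.isCompact.measurableSet
  have hlF : IsCompact (l⁻¹ • F.carrier) := F.isCompact.smul l⁻¹
  have hC0 : 0 ≤ C := (norm_nonneg _).trans (hC 1)
  have hpos : 0 < ν.real F.carrier := ENNReal.toReal_pos F.measure_pos.ne' F.measure_ne_top
  have hsh : ∫ m in F.carrier, g (l⁻¹ * m) ∂ν = ∫ m in l⁻¹ • F.carrier, g m ∂ν := by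
    rw [← integral_indicator hFm, ← integral_indicator hlF.measurableSet,
      ← integral_mul_left_eq_self ((l⁻¹ • F.carrier).indicator g) l⁻¹]
    congr 1
    ext m
    by_cases hm : m ∈ F.carrier
    · rw [Set.indicator_of_mem hm, Set.indicator_of_mem]
      exact Set.smul_mem_smul_set (a := l⁻¹) hm
    · rw [Set.indicator_of_notMem hm, Set.indicator_of_notMem]
      rwa [← smul_eq_mul, Set.smul_mem_smul_set_iff]
  have hi1 : IntegrableOn g (l⁻¹ • F.carrier) ν := hg.continuousOn.integrableOn_compact hlF
  have hi2 : IntegrableOn g F.carrier ν := hg.continuousOn.integrableOn_compact F.isCompact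
  -- Left invariance lets the Følner bound for `l` be used for `l⁻¹`.
  have hsymm : ν ((l⁻¹ • F.carrier) ∆ F.carrier) = ν ((l • F.carrier) ∆ F.carrier) := by
    rw [← measure_smul ν l, Set.smul_set_symmDiff, smul_inv_smul, symmDiff_comm]
  have hfin : ν ((l⁻¹ • F.carrier) ∆ F.carrier) ≠ ∞ :=
    ((measure_mono (Set.symmDiff_subset_union)).trans_lt
      ((measure_union_le _ _).trans_lt
        (ENNReal.add_lt_top.2 ⟨hlF.measure_lt_top, F.isCompact.measure_lt_top⟩))).ne
  have hdiff : ‖∫ m in l⁻¹ • F.carrier, g m ∂ν - ∫ m in F.carrier, g m ∂ν‖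
      ≤ C * ν.real ((l⁻¹ • F.carrier) ∆ F.carrier) := by
    rw [← integral_indicator hFm, ← integral_indicator hlF.measurableSet,
      ← integral_sub (hi1.integrable_indicator hlF.measurableSet)
        (hi2.integrable_indicator hFm)]
    have hb : ∀ m, ‖(l⁻¹ • F.carrier).indicator g m - F.carrier.indicator g m‖
        ≤ ((l⁻¹ • F.carrier) ∆ F.carrier).indicator (fun _ => C) m := by
      intro m
      by_cases h1 : m ∈ l⁻¹ • F.carrier <;> by_cases h2 : m ∈ F.carrier <;>
        simp [Set.indicator, Set.mem_symmDiff, h1, h2, hC m]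
    have hms : MeasurableSet ((l⁻¹ • F.carrier) ∆ F.carrier) := hlF.measurableSet.symmDiff hFm
    refine (norm_integral_le_of_norm_le ?_ (Eventually.of_forall hb)).trans ?_
    · exact (integrable_indicator_iff hms).2 (integrableOn_const hfin)
    · rw [integral_indicator hms, setIntegral_const, smul_eq_mul, mul_comm]
  rw [F.integral_eq, F.integral_eq, hsh, ← smul_sub, norm_smul, Real.norm_eq_abs,
    abs_of_pos (inv_pos.2 hpos)]
  have hratio : (ν.real F.carrier)⁻¹ * ν.real ((l⁻¹ • F.carrier) ∆ F.carrier) ≤ ε := by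
    have := ENNReal.toReal_le_of_le_ofReal hε hl
    rw [ENNReal.toReal_div, ← hsymm, div_eq_inv_mul] at this
    exact this
  calc (ν.real F.carrier)⁻¹ * ‖∫ m in l⁻¹ • F.carrier, g m ∂ν - ∫ m in F.carrier, g m ∂ν‖
      ≤ (ν.real F.carrier)⁻¹ * (C * ν.real ((l⁻¹ • F.carrier) ∆ F.carrier)) := by gcongr
    _ = C * ((ν.real F.carrier)⁻¹ * ν.real ((l⁻¹ • F.carrier) ∆ F.carrier)) := by ring
    _ ≤ C * ε := by gcongr

end Folner

/-! ### Axioms for the composition operators, and the averaging operators with their adjoints. -/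

section MultiplicativeSystem

open scoped InnerProductSpace

/-- An abstract form of `j` measure-preserving transformation families of a probability space:
`H` plays the role of `L²`, and `𝓑` that of `L^∞`, acting on `H` by multiplication. The
composition operators of the `k`-th family act on `𝓑` by `act k` and on `H` by `opAct k`. -/
structure MultSystem (Γ 𝓑 H : Type*) [Group Γ] [TopologicalSpace Γ] [NormedAddCommGroup 𝓑]
    [NormedSpace ℝ 𝓑] [CommMonoid 𝓑] [NormedAddCommGroup H] [InnerProductSpace ℝ H]
    (j : ℕ) where
  /-- The inclusion of `L^∞` in `L²`. -/
  emb : 𝓑 →ₗ[ℝ] H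
  /-- Multiplication operators. -/
  mul : 𝓑 → H →L[ℝ] H
  /-- Complex conjugation. -/
  conj : 𝓑 →* 𝓑
  /-- Composition operators on `L^∞`. -/
  act : ℕ → Γ → 𝓑 →* 𝓑
  /-- Composition operators on `L²`. -/
  opAct : ℕ → Γ → H →L[ℝ] H
  norm_mul_le : ∀ a b : 𝓑, ‖a * b‖ ≤ ‖a‖ * ‖b‖
  norm_one_le : ‖(1 : 𝓑)‖ ≤ 1
  norm_conj_le : ∀ a, ‖conj a‖ ≤ ‖a‖
  norm_act_le : ∀ k m a, ‖act k m a‖ ≤ ‖a‖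
  norm_opAct_le : ∀ k m v, ‖opAct k m v‖ ≤ ‖v‖
  norm_emb_le : ∀ a, ‖emb a‖ ≤ ‖a‖
  norm_mul_apply_le : ∀ a v, ‖mul a v‖ ≤ ‖a‖ * ‖v‖
  mul_emb : ∀ a b, mul a (emb b) = emb (a * b)
  opAct_emb : ∀ k m a, opAct k m (emb a) = emb (act k m a)
  inner_mul : ∀ a v w, ⟪mul a v, w⟫_ℝ = ⟪v, mul (conj a) w⟫_ℝ
  conj_act : ∀ k m a, conj (act k m a) = act k m (conj a)
  -- Ensures that averages, formed in `H`, are again represented by elements of `𝓑` with the same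
  -- bound.
  isClosed_image_closedBall : ∀ C, IsClosed (emb '' Metric.closedBall 0 C)
  inner_opAct : ∀ k < j, ∀ m v w, ⟪opAct k m v, w⟫_ℝ = ⟪v, opAct k m⁻¹ w⟫_ℝ
  act_mul : ∀ k < j, ∀ m n a, act k (m * n) a = act k n (act k m a)
  -- The commutation of the actions enters here: `U_k(m)⁻¹ U_i(m)` commutes with `U_i(l)`.
  act_comm : ∀ k < j, ∀ i < k, ∀ m l a,
    act k m⁻¹ (act i m (act i l a)) = act i l (act k m⁻¹ (act i m a))
  continuous_opAct : ∀ k < j, ∀ v, Continuous fun m => opAct k m v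

namespace MultSystem

set_option linter.unusedSectionVars false

variable {Γ 𝓑 H : Type*} [Group Γ] [TopologicalSpace Γ] [NormedAddCommGroup 𝓑]
  [NormedSpace ℝ 𝓑] [CommMonoid 𝓑] [NormedAddCommGroup H] [InnerProductSpace ℝ H] {j : ℕ}
  (S : MultSystem Γ 𝓑 H j) {Z : Type*} [TopologicalSpace Z]

/-- A uniformly bounded family in `L^∞` that is continuous in `L²`. -/
def Good (b : Z → 𝓑) : Prop :=
  (∃ C, ∀ z, ‖b z‖ ≤ C) ∧ Continuous fun z => S.emb (b z)

variable {S}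

theorem good_const (b : 𝓑) : S.Good fun _ : Z => b :=
  ⟨⟨‖b‖, fun _ => le_rfl⟩, continuous_const⟩

theorem Good.comp {Y : Type*} [TopologicalSpace Y] {b : Z → 𝓑} (hb : S.Good b) {φ : Y → Z}
    (hφ : Continuous φ) : S.Good fun y => b (φ y) :=
  ⟨⟨hb.1.choose, fun y => hb.1.choose_spec (φ y)⟩, hb.2.comp hφ⟩

/-- In `ab - a₀b₀ = a(b - b₀) + b₀(a - a₀)` the first multiplier is uniformly bounded and the second
is fixed, so continuity in `L²` alone is enough. -/
theorem Good.mul {a b : Z → 𝓑} (ha : S.Good a) (hb : S.Good b) :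
    S.Good fun z => a z * b z := by
  obtain ⟨⟨C, hC⟩, hac⟩ := ha
  obtain ⟨⟨D, hD⟩, hbc⟩ := hb
  refine ⟨⟨C * D, fun z => (S.norm_mul_le _ _).trans ?_⟩, ?_⟩
  · have := (norm_nonneg _).trans (hC z)
    gcongr
    exacts [hC z, hD z]
  rw [continuous_iff_continuousAt]
  intro z₀
  have hC0 := (norm_nonneg _).trans (hC z₀)
  rw [ContinuousAt, tendsto_iff_norm_sub_tendsto_zero]
  have h1 : Tendsto (fun z => C * ‖S.emb (b z) - S.emb (b z₀)‖ +
      ‖b z₀‖ * ‖S.emb (a z) - S.emb (a z₀)‖) (𝓝 z₀) (𝓝 (C * 0 + ‖b z₀‖ * 0)) :=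
    ((tendsto_iff_norm_sub_tendsto_zero.1 hbc.continuousAt).const_mul _).add
      ((tendsto_iff_norm_sub_tendsto_zero.1 hac.continuousAt).const_mul _)
  simp only [mul_zero, add_zero] at h1
  refine squeeze_zero (fun _ => norm_nonneg _) (fun z => ?_) h1
  have e : S.emb (a z * b z) - S.emb (a z₀ * b z₀) =
      S.mul (a z) (S.emb (b z) - S.emb (b z₀)) + S.mul (b z₀) (S.emb (a z) - S.emb (a z₀)) := by
    simp only [map_sub, S.mul_emb, mul_comm (b z₀)]
    abel
  rw [e]
  refine (norm_add_le _ _).trans (add_le_add ?_ (S.norm_mul_apply_le _ _))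
  exact (S.norm_mul_apply_le _ _).trans (by gcongr; exact hC z)

theorem Good.prod {ι : Type*} {s : Finset ι} {b : ι → Z → 𝓑} (hb : ∀ i ∈ s, S.Good (b i)) :
    S.Good fun z => ∏ i ∈ s, b i z := by
  classical
  induction s using Finset.induction_on with
  | empty => simpa using good_const (1 : 𝓑)
  | insert i s hi ih =>
    simp only [Finset.prod_insert hi]
    exact (hb i (by simp)).mul (ih fun i hi => hb i (by simp [hi]))

theorem Good.act {k : ℕ} (hk : k < j) {b : Z → 𝓑} (hb : S.Good b) {φ : Z → Γ}
    (hφ : Continuous φ) : S.Good fun z => S.act k (φ z) (b z) := by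
  obtain ⟨⟨C, hC⟩, hbc⟩ := hb
  refine ⟨⟨C, fun z => (S.norm_act_le _ _ _).trans (hC z)⟩, ?_⟩
  rw [continuous_iff_continuousAt]
  intro z₀
  rw [ContinuousAt, tendsto_iff_norm_sub_tendsto_zero]
  have h0 : Continuous fun z => S.opAct k (φ z) (S.emb (b z₀)) :=
    (S.continuous_opAct k hk _).comp hφ
  have h1 : Tendsto (fun z => ‖S.emb (b z) - S.emb (b z₀)‖ +
      ‖S.opAct k (φ z) (S.emb (b z₀)) - S.opAct k (φ z₀) (S.emb (b z₀))‖) (𝓝 z₀)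
      (𝓝 (0 + 0)) :=
    (tendsto_iff_norm_sub_tendsto_zero.1 hbc.continuousAt).add
      (tendsto_iff_norm_sub_tendsto_zero.1 h0.continuousAt)
  rw [add_zero] at h1
  refine squeeze_zero (fun _ => norm_nonneg _) (fun z => ?_) h1
  have e : S.emb (S.act k (φ z) (b z)) - S.emb (S.act k (φ z₀) (b z₀)) =
      S.opAct k (φ z) (S.emb (b z) - S.emb (b z₀)) +
      (S.opAct k (φ z) (S.emb (b z₀)) - S.opAct k (φ z₀) (S.emb (b z₀))) := by
    simp only [map_sub, S.opAct_emb]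
    abel
  rw [e]
  exact (norm_add_le _ _).trans (add_le_add (S.norm_opAct_le _ _ _) le_rfl)

variable (S) in
/-- The product `∏_{i < k} U_i(l) f_i`. -/
def prodAct (k : ℕ) (l : Γ) (f : ℕ → 𝓑) : 𝓑 := ∏ i ∈ Finset.range k, S.act i l (f i)

theorem norm_prodAct_le {C : ℝ} {f : ℕ → 𝓑} (hf : ∀ i, ‖f i‖ ≤ C) (k : ℕ) (l : Γ) :
    ‖S.prodAct k l f‖ ≤ C ^ k := by
  have hC : 0 ≤ C := (norm_nonneg _).trans (hf 0)
  induction k with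
  | zero => simpa [prodAct] using S.norm_one_le
  | succ k ih =>
    rw [prodAct, Finset.prod_range_succ, pow_succ]
    refine (S.norm_mul_le _ _).trans ?_
    gcongr
    · exact ih
    · exact (S.norm_act_le _ _ _).trans (hf k)

theorem good_prodAct {k : ℕ} (hk : k ≤ j) {f : Z → ℕ → 𝓑} (hf : ∀ i < k, S.Good fun z => f z i)
    {φ : Z → Γ} (hφ : Continuous φ) : S.Good fun z => S.prodAct k (φ z) (f z) :=
  Good.prod fun i hi => Good.act ((Finset.mem_range.1 hi).trans_le hk)
    (hf i (Finset.mem_range.1 hi)) hφ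

theorem conj_prodAct (k : ℕ) (l : Γ) (f : ℕ → 𝓑) :
    S.conj (S.prodAct k l f) = S.prodAct k l fun i => S.conj (f i) := by
  simp only [prodAct, map_prod, S.conj_act]

variable (S) in
/-- The family `f_i · U_k(m)⁻¹ U_i(m) f_i*`. -/
def twist (k : ℕ) (m : Γ) (f : ℕ → 𝓑) (i : ℕ) : 𝓑 :=
  f i * S.act k m⁻¹ (S.act i m (S.conj (f i)))

theorem norm_twist_le {C : ℝ} {f : ℕ → 𝓑} (hf : ∀ i, ‖f i‖ ≤ C) (k : ℕ) (m : Γ) (i : ℕ) :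
    ‖S.twist k m f i‖ ≤ C * C := by
  have hC : 0 ≤ C := (norm_nonneg _).trans (hf 0)
  refine (S.norm_mul_le _ _).trans ?_
  gcongr
  · exact hf i
  · exact (S.norm_act_le _ _ _).trans
      ((S.norm_act_le _ _ _).trans ((S.norm_conj_le _).trans (hf i)))

theorem good_twist [IsTopologicalGroup Γ] {k : ℕ} (hk : k < j) {i : ℕ} (hi : i < k)
    (f : ℕ → 𝓑) {φ : Z → Γ} (hφ : Continuous φ) : S.Good fun z => S.twist k (φ z) f i :=
  (good_const _).mul (Good.act hk (Good.act (hi.trans hk) (good_const _) hφ) hφ.inv)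

/-- Writing `m = l (l⁻¹ m)` turns the integrand of `U_k(l) B_F† b` into a function of `l⁻¹ m`, with
`l` otherwise only inside the functions. A translation in `m` then removes `l⁻¹`. -/
theorem act_act_inv_conj_prodAct {k : ℕ} (hk : k < j) (l m : Γ) (f : ℕ → 𝓑) (b : 𝓑) :
    S.act k l (S.act k m⁻¹ (S.conj (S.prodAct k m f) * b)) =
      S.act k (l⁻¹ * m)⁻¹
        (S.prodAct k (l⁻¹ * m) (fun i => S.act i l (S.conj (f i))) * b) := by
  rw [← S.act_mul k hk, mul_inv_rev, inv_inv, conj_prodAct]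
  congr 2
  refine Finset.prod_congr rfl fun i hi => ?_
  rw [← S.act_mul i ((Finset.mem_range.1 hi).trans hk), mul_inv_cancel_left]

/-- The regrouping that lowers the number of factors: `act_comm` moves `U_i(l)` to the outside, so
that it acts on `f_i · U_k(m)⁻¹ U_i(m) f_i*`. -/
theorem prodAct_mul_act {k : ℕ} (hk : k < j) (l m : Γ) (f : ℕ → 𝓑) (b : 𝓑) :
    S.prodAct k l f *
        S.act k m⁻¹ (S.prodAct k m (fun i => S.act i l (S.conj (f i))) * b) =
      S.act k m⁻¹ b * S.prodAct k l (S.twist k m f) := by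
  rw [map_mul, ← mul_assoc, mul_comm]
  congr 1
  rw [prodAct, prodAct, prodAct, map_prod, ← Finset.prod_mul_distrib]
  refine Finset.prod_congr rfl fun i hi => ?_
  rw [twist, map_mul, S.act_comm k hk i (Finset.mem_range.1 hi)]

variable (S) in
/-- Vectors of `H` represented by elements of `𝓑` of norm at most `C`. -/
def BoundedBy (C : ℝ) (v : H) : Prop := ∃ b, ‖b‖ ≤ C ∧ S.emb b = v

theorem BoundedBy.norm_le {C : ℝ} {v : H} (hv : S.BoundedBy C v) : ‖v‖ ≤ C := by
  obtain ⟨b, hb, rfl⟩ := hv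
  exact (S.norm_emb_le b).trans hb

theorem BoundedBy.mono {C D : ℝ} {v : H} (hv : S.BoundedBy C v) (h : C ≤ D) :
    S.BoundedBy D v := by
  obtain ⟨b, hb, rfl⟩ := hv
  exact ⟨b, hb.trans h, rfl⟩

variable [IsTopologicalGroup Γ] [T2Space Γ] [MeasurableSpace Γ] [BorelSpace Γ]
  {ν : Measure Γ} [ν.IsHaarMeasure]

theorem Good.integrable {b : Γ → 𝓑} (hb : S.Good b) (F : AveragingSet ν) :
    Integrable (fun m => S.emb (b m)) F.measure :=
  F.concentrated.integrable hb.2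

variable [CompleteSpace H]

/-- The image of a ball of `𝓑` is closed and convex in `H`, and therefore contains the averages of
its elements. -/
theorem boundedBy_integral {b : Γ → 𝓑} (hb : S.Good b) {C : ℝ} (hC : ∀ m, ‖b m‖ ≤ C)
    (F : AveragingSet ν) : S.BoundedBy C (∫ m, S.emb (b m) ∂F.measure) := by
  have hconv : Convex ℝ (S.emb '' Metric.closedBall 0 C) :=
    (convex_closedBall _ _).linear_image S.emb
  have h : ∫ m, S.emb (b m) ∂F.measure ∈ S.emb '' Metric.closedBall 0 C :=
    hconv.integral_mem (S.isClosed_image_closedBall C)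
      (Eventually.of_forall fun m => ⟨b m, by simpa using hC m, rfl⟩) (hb.integrable F)
  obtain ⟨a, ha, he⟩ := h
  exact ⟨a, by simpa using ha, he⟩

theorem mul_integral {b : Γ → 𝓑} (hb : S.Good b) (a : 𝓑) (F : AveragingSet ν) :
    S.mul a (∫ m, S.emb (b m) ∂F.measure) = ∫ m, S.emb (a * b m) ∂F.measure := by
  rw [← (S.mul a).integral_comp_comm (hb.integrable F)]
  simp only [S.mul_emb]

theorem opAct_integral {b : Γ → 𝓑} (hb : S.Good b) (k : ℕ) (m : Γ) (F : AveragingSet ν) :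
    S.opAct k m (∫ m, S.emb (b m) ∂F.measure) = ∫ n, S.emb (S.act k m (b n)) ∂F.measure := by
  rw [← (S.opAct k m).integral_comp_comm (hb.integrable F)]
  simp only [S.opAct_emb]

variable (S) in
/-- The average of `∏_{i < k} U_i(l) f_i` over `E`. -/
noncomputable def avg (k : ℕ) (E : AveragingSet ν) (f : ℕ → 𝓑) : H :=
  ∫ l, S.emb (S.prodAct k l f) ∂E.measure

variable (S) in
/-- The average of `∏_{i < k} U_i(l) f_i · U_k(l) v` over `E`. -/
noncomputable def opAvg (k : ℕ) (E : AveragingSet ν) (f : ℕ → 𝓑) (v : H) : H :=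
  ∫ l, S.mul (S.prodAct k l f) (S.opAct k l v) ∂E.measure

variable (S) in
/-- The adjoint of `opAvg`. -/
noncomputable def dualAvg (k : ℕ) (E : AveragingSet ν) (f : ℕ → 𝓑) (w : H) : H :=
  ∫ m, S.opAct k m⁻¹ (S.mul (S.conj (S.prodAct k m f)) w) ∂E.measure

theorem opAvg_emb (k : ℕ) (E : AveragingSet ν) (f : ℕ → 𝓑) (b : 𝓑) :
    S.opAvg k E f (S.emb b) = ∫ l, S.emb (S.prodAct k l f * S.act k l b) ∂E.measure := by
  simp only [opAvg, S.opAct_emb, S.mul_emb]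

theorem opAvg_emb_eq_avg (k : ℕ) (E : AveragingSet ν) (f : ℕ → 𝓑) :
    S.opAvg k E f (S.emb (f k)) = S.avg (k + 1) E f := by
  simp only [opAvg_emb, avg, prodAct, Finset.prod_range_succ]

theorem dualAvg_emb (k : ℕ) (E : AveragingSet ν) (f : ℕ → 𝓑) (b : 𝓑) :
    S.dualAvg k E f (S.emb b) =
      ∫ m, S.emb (S.act k m⁻¹ (S.conj (S.prodAct k m f) * b)) ∂E.measure := by
  simp only [dualAvg, S.opAct_emb, S.mul_emb]

theorem good_opAvg {k : ℕ} (hk : k < j) (f : ℕ → 𝓑) (b : 𝓑) :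
    S.Good fun l => S.prodAct k l f * S.act k l b :=
  (good_prodAct (f := fun _ => f) hk.le (fun i _ => good_const (f i)) continuous_id).mul
    (Good.act hk (good_const b) continuous_id)

theorem good_dualAvg {k : ℕ} (hk : k < j) (f : ℕ → 𝓑) (b : 𝓑) :
    S.Good fun m => S.act k m⁻¹ (S.conj (S.prodAct k m f) * b) := by
  simp only [conj_prodAct]
  exact Good.act hk ((good_prodAct (f := fun _ i => S.conj (f i)) hk.le
    (fun i _ => good_const (S.conj (f i))) continuous_id).mul (good_const b)) continuous_inv

theorem boundedBy_opAvg {k : ℕ} (hk : k < j) (E : AveragingSet ν) {f : ℕ → 𝓑} {C D : ℝ}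
    (hf : ∀ i, ‖f i‖ ≤ C) {v : H} (hv : S.BoundedBy D v) :
    S.BoundedBy (C ^ k * D) (S.opAvg k E f v) := by
  obtain ⟨b, hb, rfl⟩ := hv
  have hC : 0 ≤ C := (norm_nonneg _).trans (hf 0)
  rw [opAvg_emb]
  refine boundedBy_integral (good_opAvg hk f b) (fun l => (S.norm_mul_le _ _).trans ?_) E
  gcongr
  · exact norm_prodAct_le hf k l
  · exact (S.norm_act_le _ _ _).trans hb

theorem norm_conj_prodAct_mul_le {C D : ℝ} {f : ℕ → 𝓑} (hf : ∀ i, ‖f i‖ ≤ C) {b : 𝓑}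
    (hb : ‖b‖ ≤ D) (k : ℕ) (m : Γ) : ‖S.conj (S.prodAct k m f) * b‖ ≤ C ^ k * D := by
  have hC : 0 ≤ C := (norm_nonneg _).trans (hf 0)
  refine (S.norm_mul_le _ _).trans ?_
  gcongr
  exact (S.norm_conj_le _).trans (norm_prodAct_le hf k m)

theorem boundedBy_dualAvg {k : ℕ} (hk : k < j) (E : AveragingSet ν) {f : ℕ → 𝓑} {C D : ℝ}
    (hf : ∀ i, ‖f i‖ ≤ C) {v : H} (hv : S.BoundedBy D v) :
    S.BoundedBy (C ^ k * D) (S.dualAvg k E f v) := by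
  obtain ⟨b, hb, rfl⟩ := hv
  rw [dualAvg_emb]
  exact boundedBy_integral (good_dualAvg hk f b) (fun m => (S.norm_act_le _ _ _).trans
    (norm_conj_prodAct_mul_le hf hb k m)) E

theorem integrable_opAvg {k : ℕ} (hk : k < j) (E : AveragingSet ν) (f : ℕ → 𝓑) {D : ℝ} {v : H}
    (hv : S.BoundedBy D v) :
    Integrable (fun l => S.mul (S.prodAct k l f) (S.opAct k l v)) E.measure := by
  obtain ⟨b, hb, rfl⟩ := hv
  simp only [S.opAct_emb, S.mul_emb]
  exact (good_opAvg hk f b).integrable E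

theorem norm_opAvg_le {k : ℕ} (E : AveragingSet ν) {f : ℕ → 𝓑} {C : ℝ}
    (hf : ∀ i, ‖f i‖ ≤ C) (v : H) : ‖S.opAvg k E f v‖ ≤ C ^ k * ‖v‖ := by
  have hC : 0 ≤ C := (norm_nonneg _).trans (hf 0)
  have := norm_integral_le_of_norm_le_const (μ := E.measure) (Eventually.of_forall fun l =>
    ((S.norm_mul_apply_le (S.prodAct k l f) (S.opAct k l v)).trans (mul_le_mul
      (norm_prodAct_le hf k l) (S.norm_opAct_le k l v) (norm_nonneg _) (by positivity))))
  simpa [opAvg] using this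

theorem inner_opAvg {k : ℕ} (hk : k < j) (E : AveragingSet ν) (f : ℕ → 𝓑) {C D : ℝ} {v w : H}
    (hv : S.BoundedBy C v) (hw : S.BoundedBy D w) :
    ⟪S.opAvg k E f v, w⟫_ℝ = ⟪v, S.dualAvg k E f w⟫_ℝ := by
  have h1 := integrable_opAvg hk E f hv
  have h2 : Integrable (fun m => S.opAct k m⁻¹ (S.mul (S.conj (S.prodAct k m f)) w))
      E.measure := by
    obtain ⟨b, hb, rfl⟩ := hw
    simp only [S.opAct_emb, S.mul_emb]
    exact (good_dualAvg hk f b).integrable E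
  rw [real_inner_comm, opAvg, dualAvg, ← integral_inner h1, ← integral_inner h2]
  congr 1
  ext l
  rw [real_inner_comm, S.inner_mul, S.inner_opAct k hk]

end MultSystem

end MultiplicativeSystem

namespace MultSystem

open scoped InnerProductSpace

set_option linter.unusedSectionVars false

/-! ### Approximate formula for `opAvg` applied to a dual function. -/

section Approximation

variable {Γ 𝓑 H : Type*} [Group Γ] [TopologicalSpace Γ] [NormedAddCommGroup 𝓑]
  [NormedSpace ℝ 𝓑] [CommMonoid 𝓑] [NormedAddCommGroup H] [InnerProductSpace ℝ H] {j : ℕ}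
  {S : MultSystem Γ 𝓑 H j} [IsTopologicalGroup Γ] [T2Space Γ] [LocallyCompactSpace Γ]
  [MeasurableSpace Γ] [BorelSpace Γ] {ν : Measure Γ} [ν.IsHaarMeasure] [CompleteSpace H]

theorem good_mul_prodAct_twist {k : ℕ} (hk : k < j) (f : ℕ → 𝓑) (b : 𝓑) :
    S.Good fun q : Γ × Γ => S.act k q.1⁻¹ b * S.prodAct k q.2 (S.twist k q.1 f) :=
  (Good.act hk (good_const b) continuous_fst.inv).mul
    (good_prodAct (f := fun q : Γ × Γ => S.twist k q.1 f) hk.le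
      (fun _ hi => good_twist hk hi f continuous_fst) continuous_snd)

theorem continuous_avg_twist {k : ℕ} (hk : k < j) (E : AveragingSet ν) (f : ℕ → 𝓑) :
    Continuous fun m => S.avg k E (S.twist k m f) :=
  E.concentrated.continuous_integral (good_prodAct (f := fun q : Γ × Γ => S.twist k q.1 f) hk.le
    (fun _ hi => good_twist hk hi f continuous_fst) continuous_snd).2

theorem mul_avg_twist {k : ℕ} (hk : k < j) (E : AveragingSet ν) (f : ℕ → 𝓑) (b : 𝓑) (m : Γ) :
    S.mul (S.act k m⁻¹ b) (S.avg k E (S.twist k m f)) =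
      ∫ l, S.emb (S.act k m⁻¹ b * S.prodAct k l (S.twist k m f)) ∂E.measure :=
  mul_integral (good_prodAct (f := fun _ => S.twist k m f) hk.le (fun _ _ => good_const _)
    continuous_id) _ E

theorem continuous_mul_avg_twist {k : ℕ} (hk : k < j) (E : AveragingSet ν) (f : ℕ → 𝓑)
    (b : 𝓑) :
    Continuous fun m => S.mul (S.act k m⁻¹ b) (S.avg k E (S.twist k m f)) := by
  simp only [mul_avg_twist hk]
  exact E.concentrated.continuous_integral
    (f := fun m l => S.emb (S.act k m⁻¹ b * S.prodAct k l (S.twist k m f)))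
    (good_mul_prodAct_twist hk f b).2

theorem norm_avg_le {C : ℝ} {f : ℕ → 𝓑} (hf : ∀ i, ‖f i‖ ≤ C) (k : ℕ)
    (E : AveragingSet ν) : ‖S.avg k E f‖ ≤ C ^ k := by
  simpa [avg] using norm_integral_le_of_norm_le_const (μ := E.measure) (Eventually.of_forall fun l =>
    (S.norm_emb_le (S.prodAct k l f)).trans (norm_prodAct_le hf k l))

/-- Averaging against a dual function lowers the number of factors. -/
theorem norm_opAvg_dualAvg_sub_le {k : ℕ} (hk : k < j) (E F : AveragingSet ν) {f : ℕ → 𝓑}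
    {C D : ℝ} (hf : ∀ i, ‖f i‖ ≤ C) {b : 𝓑} (hb : ‖b‖ ≤ D) {η : ℝ} (hη : 0 ≤ η)
    (hl : ∀ l ∈ E.carrier, ν ((l • F.carrier) ∆ F.carrier) / ν F.carrier ≤ ENNReal.ofReal η) :
    ‖S.opAvg k E f (S.dualAvg k F f (S.emb b)) -
      ∫ m, S.mul (S.act k m⁻¹ b) (S.avg k E (S.twist k m f)) ∂F.measure‖ ≤
        C ^ k * (C ^ k * D * η) := by
  have hC : 0 ≤ C := (norm_nonneg _).trans (hf 0)
  set g : Γ → Γ → 𝓑 := fun l m =>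
    S.act k m⁻¹ (S.prodAct k m (fun i => S.act i l (S.conj (f i))) * b) with hg
  have hgood : S.Good fun q : Γ × Γ => g q.1 q.2 :=
    Good.act hk ((good_prodAct (f := fun (q : Γ × Γ) i => S.act i q.1 (S.conj (f i))) hk.le
      (fun i hi => Good.act (hi.trans hk) (good_const (S.conj (f i))) continuous_fst)
      continuous_snd).mul (good_const b)) continuous_snd.inv
  have hgl : ∀ l, S.Good (g l) := fun l =>
    hgood.comp (by fun_prop : Continuous fun m : Γ => (l, m))
  have hgb : ∀ l m, ‖S.emb (g l m)‖ ≤ C ^ k * D := fun l m => by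
    refine (S.norm_emb_le _).trans ((S.norm_act_le _ _ _).trans ((S.norm_mul_le _ _).trans ?_))
    gcongr
    exact norm_prodAct_le (fun i => (S.norm_act_le _ _ _).trans
      ((S.norm_conj_le _).trans (hf i))) k m
  -- Fubini and `prodAct_mul_act`: the target expression is `opAvg` of the dual function with `l⁻¹ *
  -- m` replaced by `m`.
  have hswap : ∫ m, S.mul (S.act k m⁻¹ b) (S.avg k E (S.twist k m f)) ∂F.measure =
      ∫ l, S.mul (S.prodAct k l f) (∫ m, S.emb (g l m) ∂F.measure) ∂E.measure := by
    have e : ∀ l, S.mul (S.prodAct k l f) (∫ m, S.emb (g l m) ∂F.measure) =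
        ∫ m, S.emb (S.act k m⁻¹ b * S.prodAct k l (S.twist k m f)) ∂F.measure := fun l => by
      rw [mul_integral (hgl l)]
      congr 1
      ext m
      rw [prodAct_mul_act hk]
    simp only [mul_avg_twist hk, e]
    exact F.concentrated.integral_swap E.concentrated (good_mul_prodAct_twist hk f b).2
  have hdual : ∀ l, S.opAct k l (S.dualAvg k F f (S.emb b)) =
      ∫ m, S.emb (g l (l⁻¹ * m)) ∂F.measure := fun l => by
    rw [dualAvg_emb, opAct_integral (good_dualAvg hk f b)]
    simp only [act_act_inv_conj_prodAct hk, hg]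
  have hint1 := integrable_opAvg hk E f (boundedBy_dualAvg (S := S) hk F hf ⟨b, hb, rfl⟩)
  have hint2 : Integrable (fun l => S.mul (S.prodAct k l f) (∫ m, S.emb (g l m) ∂F.measure))
      E.measure := by
    simp only [mul_integral (hgl _)]
    refine E.concentrated.integrable (F.concentrated.continuous_integral
      (f := fun l m => S.emb (S.prodAct k l f * g l m)) ?_)
    exact ((good_prodAct (f := fun _ : Γ × Γ => f) hk.le (fun i _ => good_const (f i))
      continuous_fst).mul hgood).2
  rw [hswap, opAvg, ← integral_sub hint1 hint2]
  have hae : ∀ᵐ l ∂E.measure, ‖S.mul (S.prodAct k l f)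
      (S.opAct k l (S.dualAvg k F f (S.emb b))) -
      S.mul (S.prodAct k l f) (∫ m, S.emb (g l m) ∂F.measure)‖ ≤ C ^ k * (C ^ k * D * η) := by
    filter_upwards [E.ae_mem] with l hlE
    rw [← map_sub, hdual]
    refine (S.norm_mul_apply_le _ _).trans ?_
    gcongr
    · exact norm_prodAct_le hf k l
    · exact F.norm_integral_translate_sub_le (hgl l).2 (hgb l) hη (hl l hlE)
  simpa using norm_integral_le_of_norm_le_const hae

/-- By Jensen's inequality and the bound on `b`, only the quadratic mean over `m` of the twisted
averages matters; this is the quantity that the induction controls. -/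
theorem norm_sq_integral_mul_avg_twist_sub_le {k : ℕ} (hk : k < j) (E E' F : AveragingSet ν)
    (f : ℕ → 𝓑) {D : ℝ} {b : 𝓑} (hb : ‖b‖ ≤ D) :
    ‖∫ m, S.mul (S.act k m⁻¹ b) (S.avg k E (S.twist k m f)) ∂F.measure -
      ∫ m, S.mul (S.act k m⁻¹ b) (S.avg k E' (S.twist k m f)) ∂F.measure‖ ^ 2 ≤
      D ^ 2 * ∫ m, ‖S.avg k E (S.twist k m f) - S.avg k E' (S.twist k m f)‖ ^ 2 ∂F.measure := by
  have h1 := continuous_mul_avg_twist (S := S) hk E f b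
  have h2 := continuous_mul_avg_twist (S := S) hk E' f b
  have h3 := continuous_avg_twist (S := S) hk E f
  have h4 := continuous_avg_twist (S := S) hk E' f
  rw [← integral_sub (F.concentrated.integrable h1) (F.concentrated.integrable h2),
    ← integral_const_mul]
  refine (norm_sq_integral_le F.concentrated (h1.sub h2)).trans ?_
  refine integral_mono (F.concentrated.integrable (by fun_prop))
    (F.concentrated.integrable (by fun_prop)) fun m => ?_
  simp only [Pi.sub_apply]
  rw [← map_sub, ← mul_pow]
  gcongr
  refine (S.norm_mul_apply_le _ _).trans ?_
  gcongr
  exact (S.norm_act_le _ _ _).trans hb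

end Approximation

/-! ### The semi-inner product space of bounded families. -/

section Families

variable {Γ 𝓑 H : Type*} [Group Γ] [TopologicalSpace Γ] [NormedAddCommGroup 𝓑]
  [NormedSpace ℝ 𝓑] [CommMonoid 𝓑] [NormedAddCommGroup H] [InnerProductSpace ℝ H] {j : ℕ}

/-- Families of vectors that are represented by uniformly bounded elements of `𝓑`. -/
def boundedFamilies (S : MultSystem Γ 𝓑 H j) (P : Type*) : Submodule ℝ (P → H) where
  carrier := {v | ∃ C, ∀ p, S.BoundedBy C (v p)}
  zero_mem' := ⟨0, fun _ => ⟨0, by simp, by simp⟩⟩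
  add_mem' := fun {v w} ⟨C, hC⟩ ⟨D, hD⟩ => ⟨C + D, fun p => by
    obtain ⟨a, ha, hav⟩ := hC p
    obtain ⟨b, hb, hbw⟩ := hD p
    exact ⟨a + b, (norm_add_le _ _).trans (add_le_add ha hb), by simp [hav, hbw]⟩⟩
  smul_mem' := fun r v ⟨C, hC⟩ => ⟨|r| * C, fun p => by
    obtain ⟨a, ha, hav⟩ := hC p
    refine ⟨r • a, ?_, by simp [hav]⟩
    rw [norm_smul, Real.norm_eq_abs]
    gcongr⟩

/-- The space of bounded families with the semi-inner product given by a mean. -/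
def MeanSpace (S : MultSystem Γ 𝓑 H j) {P : Type*} {m : (P → ℝ) →ₗ[ℝ] ℝ}
    (_hm : IsMean m) : Type _ := S.boundedFamilies P

variable {S : MultSystem Γ 𝓑 H j} {P : Type*} {m : (P → ℝ) →ₗ[ℝ] ℝ} {hm : IsMean m}

noncomputable instance : AddCommGroup (S.MeanSpace hm) :=
  inferInstanceAs (AddCommGroup (S.boundedFamilies P))

noncomputable instance : Module ℝ (S.MeanSpace hm) :=
  inferInstanceAs (Module ℝ (S.boundedFamilies P))

theorem MeanSpace.exists_bound (v : S.MeanSpace hm) : ∃ C, ∀ p, S.BoundedBy C (v.1 p) := v.2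

theorem MeanSpace.exists_norm_le (v : S.MeanSpace hm) : ∃ C, ∀ p, ‖v.1 p‖ ≤ C :=
  v.2.imp fun _ h p => (h p).norm_le

/-- The semi-inner product. -/
noncomputable instance MeanSpace.core :
    PreInnerProductSpace.Core ℝ (S.MeanSpace hm) where
  inner v w := m fun p => ⟪v.1 p, w.1 p⟫_ℝ
  conj_inner_symm v w := by simp only [real_inner_comm, conj_trivial]
  re_inner_nonneg v := by
    obtain ⟨C, hC⟩ := v.exists_norm_le
    refine hm _ ⟨C ^ 2, fun p => ?_⟩ fun p => real_inner_self_nonneg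
    rw [real_inner_self_eq_norm_sq]
    gcongr
    exact hC p
  add_left u v w := by
    rw [← map_add]
    congr 1
    ext p
    exact inner_add_left _ _ _
  smul_left v w r := by
    rw [conj_trivial, ← smul_eq_mul, ← map_smul]
    congr 1
    ext p
    exact real_inner_smul_left _ _ _

noncomputable instance : SeminormedAddCommGroup (S.MeanSpace hm) :=
  InnerProductSpace.Core.toSeminormedAddCommGroup (𝕜 := ℝ)

noncomputable instance : InnerProductSpace ℝ (S.MeanSpace hm) :=
  InnerProductSpace.ofCore MeanSpace.core

theorem MeanSpace.inner_def (v w : S.MeanSpace hm) :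
    ⟪v, w⟫_ℝ = m fun p => ⟪v.1 p, w.1 p⟫_ℝ := rfl

theorem MeanSpace.norm_sq (v : S.MeanSpace hm) : ‖v‖ ^ 2 = m fun p => ‖v.1 p‖ ^ 2 := by
  rw [← real_inner_self_eq_norm_sq, MeanSpace.inner_def]
  simp only [real_inner_self_eq_norm_sq]

end Families

end MultSystem

/-- Iterating a mean with the limit of a sequence of normalized means. -/
theorem exists_iterated_mean {ι P Ω : Type*} (ω : Ultrafilter ι) {m : (P → ℝ) →ₗ[ℝ] ℝ}
    (hm : IsMean m) (n : ι → (Ω → ℝ) →ₗ[ℝ] ℝ) (hn : ∀ i, IsMean (n i))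
    (hn1 : ∀ i C, (n i fun _ => C) = C) :
    ∃ m' : (P × Ω → ℝ) →ₗ[ℝ] ℝ, IsMean m' ∧ ∀ G C, (∀ q, |G q| ≤ C) →
      Tendsto (fun i => m fun p => n i fun x => G (p, x)) ω (𝓝 (m' G)) := by
  obtain ⟨L, hL⟩ := exists_linear_limit (ω : Filter ι)
  let m' : (P × Ω → ℝ) →ₗ[ℝ] ℝ :=
    { toFun := fun G => L fun i => m fun p => n i fun x => G (p, x)
      map_add' := fun G G' => by
        rw [← map_add]
        congr 1
        ext i
        rw [Pi.add_apply, ← map_add]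
        congr 1
        ext p
        rw [Pi.add_apply, ← map_add]
        rfl
      map_smul' := fun r G => by
        rw [RingHom.id_apply, ← map_smul]
        congr 1
        ext i
        rw [Pi.smul_apply, ← map_smul]
        congr 1
        ext p
        rw [Pi.smul_apply, ← map_smul]
        rfl }
  have hlim : ∀ G C, (∀ q, |G q| ≤ C) →
      Tendsto (fun i => m fun p => n i fun x => G (p, x)) ω (𝓝 (m' G)) := by
    intro G C hG
    -- For bounded `G` the limit exists because `ω` is an ultrafilter; `L` serves only to make `m'`
    -- linear on all functions.
    obtain ⟨c, -, hc⟩ := exists_tendsto_ultrafilter_of_abs_le ω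
      (x := fun i => m fun p => n i fun x => G (p, x)) (C := m fun _ => C) fun i =>
        hm.abs_le fun p => by
          have := (hn i).abs_le fun x => hG (p, x)
          rwa [hn1] at this
    have : m' G = c := hL _ c hc
    rwa [this]
  refine ⟨m', ?_, hlim⟩
  rintro G ⟨C, hC⟩ h0
  have hGC : ∀ q, |G q| ≤ C := fun q => by rw [abs_of_nonneg (h0 q)]; exact hC q
  refine ge_of_tendsto' (hlim G C hGC) fun i => ?_
  refine hm _ ⟨C, fun p => ?_⟩ fun p => hn i _ ⟨C, fun x => hC (p, x)⟩ fun x => h0 (p, x)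
  have := (hn i).abs_le fun x => hGC (p, x)
  rw [hn1] at this
  exact (le_abs_self _).trans this

/-! ### Induction on the number of factors. -/

namespace MultSystem

open scoped InnerProductSpace

set_option linter.unusedSectionVars false

universe u

variable {Γ : Type u} {𝓑 H : Type*} [Group Γ] [TopologicalSpace Γ] [NormedAddCommGroup 𝓑]
  [NormedSpace ℝ 𝓑] [CommMonoid 𝓑] [NormedAddCommGroup H] [InnerProductSpace ℝ H] {j : ℕ}
  {S : MultSystem Γ 𝓑 H j} [IsTopologicalGroup Γ] [T2Space Γ]
  [MeasurableSpace Γ] [BorelSpace Γ] {ν : Measure Γ} [ν.IsHaarMeasure] [CompleteSpace H]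

variable (S ν) in
/-- The averages of `k` factors are Cauchy along the Følner filter, in quadratic mean over an
arbitrary uniformly bounded family of systems of functions. -/
def MeanCauchy (k : ℕ) : Prop :=
  ∀ (P : Type u) (m : (P → ℝ) →ₗ[ℝ] ℝ), IsMean m → ∀ (f : P → ℕ → 𝓑) (C : ℝ),
    (∀ p i, ‖f p i‖ ≤ C) → ∀ ε > 0, ∀ᶠ q in folnerFilter ν ×ˢ folnerFilter ν,
      (m fun p => ‖S.avg k q.1 (f p) - S.avg k q.2 (f p)‖ ^ 2) ≤ ε

/-- The averaging operators on bounded families. -/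
noncomputable def familyAvg {k : ℕ} (hk : k < j) {P : Type*} {m : (P → ℝ) →ₗ[ℝ] ℝ}
    (hm : IsMean m) {f : P → ℕ → 𝓑} {C : ℝ} (hf : ∀ p i, ‖f p i‖ ≤ C) (F : AveragingSet ν) :
    S.MeanSpace hm →ₗ[ℝ] S.MeanSpace hm where
  toFun v := ⟨fun p => S.opAvg k F (f p) (v.1 p), v.exists_bound.elim fun D hD =>
    ⟨C ^ k * D, fun p => boundedBy_opAvg hk F (hf p) (hD p)⟩⟩
  map_add' v w := Subtype.ext <| funext fun p => by
    obtain ⟨D, hD⟩ := v.exists_bound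
    obtain ⟨D', hD'⟩ := w.exists_bound
    change S.opAvg k F (f p) (v.1 p + w.1 p) =
      S.opAvg k F (f p) (v.1 p) + S.opAvg k F (f p) (w.1 p)
    simp only [opAvg, map_add]
    exact integral_add (integrable_opAvg hk F (f p) (hD p)) (integrable_opAvg hk F (f p) (hD' p))
  map_smul' r v := Subtype.ext <| funext fun p => by
    change S.opAvg k F (f p) (r • v.1 p) = r • S.opAvg k F (f p) (v.1 p)
    simp only [opAvg, map_smul]
    exact integral_smul _ _

/-- The adjoint of `familyAvg`. -/
noncomputable def familyDual {k : ℕ} (hk : k < j) {P : Type*} {m : (P → ℝ) →ₗ[ℝ] ℝ}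
    (hm : IsMean m) {f : P → ℕ → 𝓑} {C : ℝ} (hf : ∀ p i, ‖f p i‖ ≤ C) (F : AveragingSet ν)
    (v : S.MeanSpace hm) : S.MeanSpace hm :=
  ⟨fun p => S.dualAvg k F (f p) (v.1 p), v.exists_bound.elim fun D hD =>
    ⟨C ^ k * D, fun p => boundedBy_dualAvg hk F (hf p) (hD p)⟩⟩

theorem norm_familyAvg_le {k : ℕ} (hk : k < j) {P : Type*} {m : (P → ℝ) →ₗ[ℝ] ℝ}
    (hm : IsMean m) {f : P → ℕ → 𝓑} {C : ℝ} (hC : 0 ≤ C) (hf : ∀ p i, ‖f p i‖ ≤ C)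
    (F : AveragingSet ν) (v : S.MeanSpace hm) : ‖familyAvg hk hm hf F v‖ ≤ C ^ k * ‖v‖ := by
  rw [← sq_le_sq₀ (norm_nonneg _) (by positivity), mul_pow, MeanSpace.norm_sq,
    MeanSpace.norm_sq, ← smul_eq_mul, ← map_smul]
  obtain ⟨D, hD⟩ := v.exists_norm_le
  refine hm.mono (C := (C ^ k) ^ 2 * D ^ 2) (fun p => ?_) (fun p => ?_) fun p => ?_
  · exact (neg_nonpos.2 (by positivity)).trans (by positivity)
  · simp only [Pi.smul_apply, smul_eq_mul]
    gcongr
    exact hD p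
  · simp only [Pi.smul_apply, smul_eq_mul]
    rw [← mul_pow]
    gcongr
    exact norm_opAvg_le F (hf p) (v.1 p)

theorem inner_familyAvg {k : ℕ} (hk : k < j) {P : Type*} {m : (P → ℝ) →ₗ[ℝ] ℝ}
    (hm : IsMean m) {f : P → ℕ → 𝓑} {C : ℝ} (hf : ∀ p i, ‖f p i‖ ≤ C)
    (F : AveragingSet ν) (v w : S.MeanSpace hm) :
    ⟪familyAvg hk hm hf F v, w⟫_ℝ = ⟪v, familyDual hk hm hf F w⟫_ℝ := by
  obtain ⟨D, hD⟩ := v.exists_bound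
  obtain ⟨D', hD'⟩ := w.exists_bound
  rw [MeanSpace.inner_def, MeanSpace.inner_def]
  congr 1
  ext p
  exact inner_opAvg (S := S) hk F (f p) (hD p) (hD' p)

/-- The pointwise estimate behind the induction. -/
theorem norm_sq_opAvg_dualAvg_sub_le [LocallyCompactSpace Γ] {k : ℕ} (hk : k < j)
    (E E' F : AveragingSet ν) {f : ℕ → 𝓑} {C D : ℝ} (hf : ∀ i, ‖f i‖ ≤ C) {u : H}
    (hu : S.BoundedBy D u) {η : ℝ} (hη : 0 ≤ η)
    (hl : ∀ l ∈ E.carrier, ν ((l • F.carrier) ∆ F.carrier) / ν F.carrier ≤ ENNReal.ofReal η)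
    (hl' : ∀ l ∈ E'.carrier, ν ((l • F.carrier) ∆ F.carrier) / ν F.carrier ≤ ENNReal.ofReal η) :
    ‖S.opAvg k E f (S.dualAvg k F f u) - S.opAvg k E' f (S.dualAvg k F f u)‖ ^ 2 ≤
      8 * (C ^ k * (C ^ k * D * η)) ^ 2 + 2 * D ^ 2 *
        ∫ m, ‖S.avg k E (S.twist k m f) - S.avg k E' (S.twist k m f)‖ ^ 2 ∂F.measure := by
  obtain ⟨b, hb, rfl⟩ := hu
  have h1 := norm_opAvg_dualAvg_sub_le (S := S) hk E F hf hb hη hl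
  have h2 := norm_opAvg_dualAvg_sub_le (S := S) hk E' F hf hb hη hl'
  have h3 := norm_sq_integral_mul_avg_twist_sub_le (S := S) hk E E' F f hb
  set a := S.opAvg k E f (S.dualAvg k F f (S.emb b))
  set a' := S.opAvg k E' f (S.dualAvg k F f (S.emb b))
  set c := ∫ m, S.mul (S.act k m⁻¹ b) (S.avg k E (S.twist k m f)) ∂F.measure
  set c' := ∫ m, S.mul (S.act k m⁻¹ b) (S.avg k E' (S.twist k m f)) ∂F.measure
  set M := C ^ k * (C ^ k * D * η)
  have h4 : ‖a - a'‖ ≤ 2 * M + ‖c - c'‖ := by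
    have e : a - a' = (a - c) + (c - c') - (a' - c') := by abel
    rw [e]
    have := norm_sub_le ((a - c) + (c - c')) (a' - c')
    have := norm_add_le (a - c) (c - c')
    linarith
  have h5 : ‖a - a'‖ ^ 2 ≤ (2 * M + ‖c - c'‖) ^ 2 := by gcongr
  -- This is `(2M + x)² ≤ 8M² + 2x²`.
  nlinarith [sq_nonneg (2 * M - ‖c - c'‖)]

/-- The pair of sets in the Cauchy condition is chosen before the dual set `F`, which may then be
taken almost invariant under both. The hypothesis is applied to the twisted functions over `P × Γ`,
which is why it must allow all families and means. -/
theorem MeanCauchy.succ [LocallyCompactSpace Γ] {k : ℕ} (hk : k < j) (ih : S.MeanCauchy ν k) :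
    S.MeanCauchy ν (k + 1) := by
  intro P m hm f C₀ hf₀ ε hε
  obtain ⟨C, hC, hf⟩ : ∃ C, 0 ≤ C ∧ ∀ p i, ‖f p i‖ ≤ C :=
    ⟨|C₀|, abs_nonneg _, fun p i => (hf₀ p i).trans (le_abs_self _)⟩
  have key := cauchy_of_cauchy_on_formal_adjoint_range (folnerFilter ν)
    (familyAvg (S := S) hk hm hf) (familyDual hk hm hf) (norm_familyAvg_le hk hm hC hf)
    (inner_familyAvg hk hm hf) (by
    intro v ω hω δ hδ
    obtain ⟨D, hD0, hD⟩ : ∃ D, 0 ≤ D ∧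
        ∀ F p, S.BoundedBy D ((familyAvg (ν := ν) hk hm hf F v).1 p) := by
      obtain ⟨D₀, hD₀⟩ := v.exists_bound
      exact ⟨|C ^ k * D₀|, abs_nonneg _, fun F p =>
        (boundedBy_opAvg hk F (hf p) (hD₀ p)).mono (le_abs_self _)⟩
    -- Averages over `F` are extended to all functions, as families over `P × Γ` carry no
    -- measurability; `hni` recovers the integral for the continuous integrands that occur.
    choose n hn hni using fun F : AveragingSet ν => exists_mean_extending_integral F.measure
    have hn1 : ∀ F c, (n F fun _ => c) = c := fun F c => by
      rw [hni F _ ⟨|c|, fun _ => le_rfl⟩ (integrable_const c)]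
      simp
    obtain ⟨m', hm', hlim⟩ := exists_iterated_mean ω hm n hn hn1
    set κ : ℝ := m fun _ => 1 with hκ
    have hκ0 : 0 ≤ κ := hm _ ⟨1, fun _ => le_rfl⟩ fun _ => zero_le_one
    -- With a factor `2` lost in passing from the limit to a single `F`, the term `2 D² ∫ ‖⋯‖²` is
    -- at most `δ² / 2`.
    have hα : 0 < δ ^ 2 / (8 * (D ^ 2 + 1)) := by positivity
    filter_upwards [ih (P × Γ) m' hm' (fun q => S.twist k q.2 (f q.1)) (C * C)
      (fun q i => norm_twist_le (hf q.1) k q.2 i) _ hα] with q hq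
    set X : P × Γ → ℝ := fun r => ‖S.avg k q.1 (S.twist k r.2 (f r.1)) -
      S.avg k q.2 (S.twist k r.2 (f r.1))‖ ^ 2 with hX
    set R : ℝ := ((C * C) ^ k + (C * C) ^ k) ^ 2 with hR
    have hXR : ∀ r, |X r| ≤ R := fun r => by
      rw [abs_of_nonneg (by positivity)]
      have h1 := norm_avg_le (S := S) (norm_twist_le (S := S) (hf r.1) k r.2) k q.1
      have h2 := norm_avg_le (S := S) (norm_twist_le (S := S) (hf r.1) k r.2) k q.2
      simp only [hX, hR]
      gcongr
      exact (norm_sub_le _ _).trans (add_le_add h1 h2)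
    have hev := (hlim X R hXR).eventually
      (gt_mem_nhds (hq.trans_lt (by linarith : _ < 2 * (δ ^ 2 / (8 * (D ^ 2 + 1))))))
    set M : ℝ := C ^ k * (C ^ k * D) with hM
    have hM0 : 0 ≤ M := by positivity
    -- The mean is not normalized, so its total mass `κ` enters; this choice gives `8 (M η)² κ ≤ δ²
    -- / 2`.
    set η : ℝ := δ / (4 * (M + 1) * (κ + 1)) with hη
    have hη0 : 0 < η := by positivity
    filter_upwards [hev,
      hω (eventually_folnerFilter q.1.isCompact (ENNReal.ofReal_pos.2 hη0)),
      hω (eventually_folnerFilter q.2.isCompact (ENNReal.ofReal_pos.2 hη0))] with F hF hl hl'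
    have hnX : ∀ p, (n F fun x => X (p, x)) = ∫ x, X (p, x) ∂F.measure := fun p =>
      hni F _ ⟨R, fun x => hXR (p, x)⟩ (F.concentrated.integrable
        (((continuous_avg_twist hk q.1 (f p)).sub (continuous_avg_twist hk q.2 (f p))).norm.pow 2))
    have hnXb : ∀ p, |n F fun x => X (p, x)| ≤ R := fun p => by
      have := (hn F).abs_le fun x => hXR (p, x)
      rwa [hn1] at this
    have hpt : ∀ p, ‖(familyAvg hk hm hf q.1 (familyDual hk hm hf F (familyAvg hk hm hf F v)) -
        familyAvg hk hm hf q.2 (familyDual hk hm hf F (familyAvg hk hm hf F v))).1 p‖ ^ 2 ≤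
        ((8 * (M * η) ^ 2) • (fun _ : P => (1 : ℝ)) +
          (2 * D ^ 2) • fun p => n F fun x => X (p, x)) p := fun p => by
      have := norm_sq_opAvg_dualAvg_sub_le hk q.1 q.2 F (hf p) (hD F p) hη0.le hl hl'
      simp only [Pi.add_apply, Pi.smul_apply, smul_eq_mul, mul_one, hnX]
      refine this.trans (le_of_eq ?_)
      simp only [hM, hX]
      ring
    rw [← sq_le_sq₀ (norm_nonneg _) hδ.le, MeanSpace.norm_sq]
    refine (hm.mono (C := 8 * (M * η) ^ 2 + 2 * D ^ 2 * R) (fun p => ?_) (fun p => ?_)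
      hpt).trans ?_
    · have hR0 : 0 ≤ R := by positivity
      exact (neg_nonpos.2 (by positivity)).trans (by positivity)
    · simp only [Pi.add_apply, Pi.smul_apply, smul_eq_mul, mul_one]
      gcongr
      exact (le_abs_self _).trans (hnXb p)
    · rw [map_add, map_smul, map_smul, smul_eq_mul, smul_eq_mul, ← hκ]
      have b1 : 8 * (M * η) ^ 2 * κ ≤ δ ^ 2 / 2 := by
        have h1 : M * η * (κ + 1) ≤ δ / 4 := by
          have e : M * η * (κ + 1) = δ / 4 * (M / (M + 1)) := by
            rw [hη]; field_simp
          rw [e]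
          have : M / (M + 1) ≤ 1 := (div_le_one (by positivity)).2 (by linarith)
          nlinarith
        have h2 : 0 ≤ M * η := by positivity
        have h3 : (M * η * (κ + 1)) ^ 2 ≤ (δ / 4) ^ 2 := by gcongr
        have h4 : (M * η) ^ 2 * κ ≤ (M * η * (κ + 1)) ^ 2 := by
          rw [mul_pow (M * η)]
          gcongr
          nlinarith
        nlinarith
      have b2 : 2 * D ^ 2 * (m fun p => n F fun x => X (p, x)) ≤ δ ^ 2 / 2 := by
        calc 2 * D ^ 2 * (m fun p => n F fun x => X (p, x))
            ≤ 2 * (D ^ 2 + 1) * (2 * (δ ^ 2 / (8 * (D ^ 2 + 1)))) := by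
              have h0 : 0 ≤ 2 * (δ ^ 2 / (8 * (D ^ 2 + 1))) := by positivity
              refine (mul_le_mul_of_nonneg_left hF.le (by positivity)).trans ?_
              gcongr
              linarith
          _ = δ ^ 2 / 2 := by field_simp; norm_num
      linarith)
  -- Applied to the family of last functions, the operators are the averages with `k + 1` factors.
  let v₀ : S.MeanSpace hm := ⟨fun p => S.emb (f p k), C, fun p => ⟨_, hf p k, rfl⟩⟩
  filter_upwards [key v₀ (√ε) (Real.sqrt_pos.2 hε)] with q hq
  have h := pow_le_pow_left₀ (norm_nonneg _) hq 2
  rw [Real.sq_sqrt hε.le, MeanSpace.norm_sq] at h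
  have e : ∀ p, (familyAvg hk hm hf q.1 v₀ - familyAvg hk hm hf q.2 v₀).1 p =
      S.avg (k + 1) q.1 (f p) - S.avg (k + 1) q.2 (f p) := fun p => by
    rw [← opAvg_emb_eq_avg, ← opAvg_emb_eq_avg]
    rfl
  simpa only [e] using h

theorem meanCauchy [LocallyCompactSpace Γ] {k : ℕ} (hk : k ≤ j) : S.MeanCauchy ν k := by
  induction k with
  | zero =>
    intro P m hm f C hf ε hε
    refine Eventually.of_forall fun q => ?_
    have e : (fun p => ‖S.avg 0 q.1 (f p) - S.avg 0 q.2 (f p)‖ ^ 2) = 0 := by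
      ext p
      simp [avg, prodAct]
    rw [e, map_zero]
    exact hε.le
  | succ k ih => exact (ih (Nat.le_of_succ_le hk)).succ hk

/-- Multiple averages converge along the Følner filter. -/
theorem exists_tendsto_avg [LocallyCompactSpace Γ] (f : ℕ → 𝓑) {C : ℝ} (hf : ∀ i, ‖f i‖ ≤ C) :
    ∃ L, Tendsto (fun F : AveragingSet ν => S.avg j F f) (folnerFilter ν) (𝓝 L) := by
  -- The filter is trivial when there are no sufficiently invariant sets; any limit then works.
  rcases (folnerFilter ν).eq_or_neBot with h | h
  · exact ⟨0, h ▸ tendsto_bot⟩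
  rw [← cauchy_map_iff_exists_tendsto, cauchy_map_iff]
  refine ⟨h, ?_⟩
  rw [Metric.uniformity_basis_dist_le.tendsto_right_iff]
  intro ε hε
  filter_upwards [meanCauchy (S := S) (ν := ν) le_rfl PUnit (LinearMap.proj PUnit.unit)
    (isMean_eval _) (fun _ => f) C (fun _ => hf) (ε ^ 2) (by positivity)] with q hq
  rw [dist_eq_norm]
  exact (sq_le_sq₀ (norm_nonneg _) (le_of_lt hε)).1 hq

end MultSystem

/-! ### Algebra of products of commuting antihomomorphisms. -/

section PartialProducts

set_option linter.unusedSectionVars false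

variable {M G : Type*} [Monoid M] [Group G]

/-- The products `t_{k-1}(m) ⋯ t_0(m)`. -/
def partialProd (t : ℕ → G → M) : ℕ → G → M
  | 0, _ => 1
  | k + 1, m => t k m * partialProd t k m

variable {t : ℕ → G → M} (h1 : ∀ k, t k 1 = 1) (hmul : ∀ k m n, t k (m * n) = t k n * t k m)
  (hc : ∀ i k, i ≠ k → ∀ m n, t i m * t k n = t k n * t i m)

include hc in
theorem commute_partialProd {k q : ℕ} (hkq : k ≤ q) (m n : G) :
    t q m * partialProd t k n = partialProd t k n * t q m := by
  induction k with
  | zero => simp [partialProd]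
  | succ k ih =>
    rw [partialProd, ← mul_assoc, hc q k (by omega), mul_assoc, ih (by omega), mul_assoc]

include h1 in
theorem partialProd_one (k : ℕ) : partialProd t k 1 = 1 := by
  induction k with
  | zero => rfl
  | succ k ih => rw [partialProd, ih, h1, mul_one]

include hmul hc in
theorem partialProd_mul (k : ℕ) (m n : G) :
    partialProd t k (m * n) = partialProd t k n * partialProd t k m := by
  induction k with
  | zero => simp [partialProd]
  | succ k ih =>
    rw [partialProd, partialProd, partialProd, ih, hmul, mul_assoc, mul_assoc,
      ← mul_assoc (t k m), commute_partialProd hc le_rfl m n, mul_assoc]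

include h1 hmul hc in
-- For `k = i` both sides reduce to `partialProd t i l`. Each further factor `t k m⁻¹` has index at
-- least `i` and commutes with `partialProd t i l`.
theorem partialProd_comm {i k : ℕ} (hik : i ≤ k) (m l : G) :
    partialProd t k m⁻¹ * (partialProd t i m * partialProd t i l) =
      partialProd t i l * (partialProd t k m⁻¹ * partialProd t i m) := by
  induction k, hik using Nat.le_induction with
  | base =>
    rw [← mul_assoc, ← partialProd_mul hmul hc, mul_inv_cancel, partialProd_one h1, one_mul,
      mul_one]
  | succ k hik ih =>
    rw [partialProd, mul_assoc, ih, ← mul_assoc, commute_partialProd hc hik, mul_assoc, mul_assoc]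

end PartialProducts

/-! ### Measurable isometric representations are continuous. -/

section Continuity

variable {Γ H : Type*} [Group Γ] [TopologicalSpace Γ] [IsTopologicalGroup Γ]
  [LocallyCompactSpace Γ] [T2Space Γ] [MeasurableSpace Γ] [BorelSpace Γ] (ν : Measure Γ)
  [ν.IsHaarMeasure] [ν.Regular] [NormedAddCommGroup H]

/-- Measurable representations by isometries are strongly continuous. -/
theorem continuous_orbit_of_aestronglyMeasurable {U : Γ → H → H}
    (hiso : ∀ m v w, ‖U m v - U m w‖ = ‖v - w‖)
    (hmul : ∀ m n v, U (m * n) v = U n (U m v))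
    (hmeas : ∀ v, ∀ K : Set Γ, IsCompact K →
      AEStronglyMeasurable (fun m => U m v) (ν.restrict K)) (v : H) :
    Continuous fun m => U m v := by
  have key : ∀ v, ContinuousAt (fun m => U m v) 1 := by
    intro v
    rw [ContinuousAt, Metric.tendsto_nhds]
    intro ε hε
    obtain ⟨K, hK, hK1⟩ := exists_compact_mem_nhds (1 : Γ)
    have hKpos : 0 < ν K := Measure.measure_pos_of_mem_nhds ν hK1
    obtain ⟨g, hg, hgU⟩ := hmeas v K hK
    obtain ⟨s, hsc, hs⟩ := hg.isSeparable_range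
    -- The range of `g` is separable, so countably many balls cover it and one of them has a
    -- preimage of positive measure.
    obtain ⟨w, -, hw⟩ : ∃ w ∈ s, 0 < ν.restrict K (g ⁻¹' Metric.ball w (ε / 2)) := by
      by_contra! hcon
      have h0 : ν.restrict K (⋃ w ∈ s, g ⁻¹' Metric.ball w (ε / 2)) = 0 :=
        (measure_biUnion_null_iff hsc).2 fun w hw => nonpos_iff_eq_zero.1 (hcon w hw)
      have hU : (⋃ w ∈ s, g ⁻¹' Metric.ball w (ε / 2)) = Set.univ := by
        rw [Set.eq_univ_iff_forall]
        intro m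
        obtain ⟨w, hw, hmw⟩ := Metric.mem_closure_iff.1 (hs (Set.mem_range_self m)) (ε / 2)
          (by positivity)
        exact Set.mem_biUnion hw hmw
      rw [hU, Measure.restrict_apply_univ] at h0
      exact hKpos.ne' h0
    set N := toMeasurable (ν.restrict K) {m | ¬ U m v = g m} with hN
    have hN0 : ν.restrict K N = 0 := by rw [hN, measure_toMeasurable]; exact ae_iff.1 hgU
    have hball : MeasurableSet (g ⁻¹' Metric.ball w (ε / 2)) := by
      have := (hg.dist (stronglyMeasurable_const (b := w))).measurable
      exact this measurableSet_Iio
    set E := (g ⁻¹' Metric.ball w (ε / 2) \ N) ∩ K with hE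
    have hEm : MeasurableSet E :=
      (hball.diff (measurableSet_toMeasurable _ _)).inter hK.measurableSet
    have hEν : ν E = ν.restrict K (g ⁻¹' Metric.ball w (ε / 2)) := by
      rw [hE, ← Measure.restrict_apply (hball.diff (measurableSet_toMeasurable _ _)),
        measure_sdiff_null hN0]
    have hEfin : ν E ≠ ∞ := ((measure_mono Set.inter_subset_right).trans_lt hK.measure_lt_top).ne
    -- Steinhaus: `E / E` is a neighbourhood of `1`. For `m, n ∈ E` the isometry `U n⁻¹` carries `U
    -- m v` and `U n v`, both near `w`, to `U (m / n) v` and `U 1 v`.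
    have hEE := Measure.div_mem_nhds_one_of_haar_pos_ne_top ν E hEm (hEν ▸ hw) hEfin
    have hEU : ∀ m ∈ E, dist (U m v) w < ε / 2 := by
      rintro m ⟨⟨hm1, hm2⟩, -⟩
      have : U m v = g m := by
        by_contra h
        exact hm2 (subset_toMeasurable _ _ h)
      rw [this]
      exact hm1
    filter_upwards [hEE] with x hx
    obtain ⟨m, hm, n, hn, rfl⟩ := hx
    change dist (U (m / n) v) (U 1 v) < ε
    have e : U 1 v = U n⁻¹ (U n v) := by rw [← hmul, mul_inv_cancel]
    rw [div_eq_mul_inv, hmul, e, dist_eq_norm, hiso, ← dist_eq_norm]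
    exact (dist_triangle_right _ _ w).trans_lt (by linarith [hEU m hm, hEU n hn])
  rw [continuous_iff_continuousAt]
  intro m₀
  have h2 : ContinuousAt (fun m => U (m₀⁻¹ * m) (U m₀ v)) m₀ := by
    refine ContinuousAt.comp (f := fun m => m₀⁻¹ * m) (g := fun x => U x (U m₀ v)) ?_
      (by fun_prop)
    simpa using key (U m₀ v)
  refine h2.congr (Eventually.of_forall fun m => ?_)
  simp only
  rw [← hmul, mul_inv_cancel_left]

end Continuity

/-! ### Composition operators of measure-preserving actions. -/

section CompositionOperators

variable {Γ X : Type*} [Group Γ] [TopologicalSpace Γ] [MeasurableSpace Γ]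
  [MeasurableSpace X] {ν : Measure Γ} {μ : Measure X} {E : Type*} [NormedAddCommGroup E]

/-- Composition with a measure-preserving map. -/
noncomputable def compEnd (E : Type*) [NormedAddCommGroup E] (p : ℝ≥0∞) {T : X → X}
    (hT : MeasurePreserving T μ μ) : AddMonoid.End (Lp E p μ) :=
  Lp.compMeasurePreserving T hT

theorem compEnd_congr {p : ℝ≥0∞} {T T' : X → X} (hT : MeasurePreserving T μ μ)
    (hT' : MeasurePreserving T' μ μ) (h : T =ᵐ[μ] T') : compEnd E p hT = compEnd E p hT' := by
  ext1 f
  exact Subtype.ext (AEEqFun.compMeasurePreserving_congr f.1 hT hT'.measurable h)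

theorem compEnd_comp {p : ℝ≥0∞} {T T' : X → X} (hT : MeasurePreserving T μ μ)
    (hT' : MeasurePreserving T' μ μ) :
    compEnd E p (hT.comp hT') = compEnd E p hT' * compEnd E p hT :=
  Lp.compMeasurePreserving_comp hT hT'

theorem compEnd_id {p : ℝ≥0∞} : compEnd E p (MeasurePreserving.id μ) = 1 :=
  Lp.compMeasurePreserving_id

namespace IsMeasurePreservingAction

theorem compEnd_one {τ : Γ → X → X} (h : IsMeasurePreservingAction ν μ τ) (p : ℝ≥0∞) :
    compEnd E p (h.measurePreserving 1) = 1 := by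
  rw [compEnd_congr _ (MeasurePreserving.id μ) h.map_one, compEnd_id]

theorem compEnd_mul {τ : Γ → X → X} (h : IsMeasurePreservingAction ν μ τ) (p : ℝ≥0∞) (m n : Γ) :
    compEnd E p (h.measurePreserving (m * n)) =
      compEnd E p (h.measurePreserving n) * compEnd E p (h.measurePreserving m) := by
  rw [compEnd_congr _ ((h.measurePreserving m).comp (h.measurePreserving n)) (h.map_mul m n),
    compEnd_comp]

theorem continuous_compEnd_real [IsTopologicalGroup Γ] [LocallyCompactSpace Γ] [T2Space Γ]
    [BorelSpace Γ] [ν.IsHaarMeasure] [ν.Regular] {τ : Γ → X → X}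
    (h : IsMeasurePreservingAction ν μ τ) (f : Lp ℝ 2 μ) :
    Continuous fun m => compEnd ℝ 2 (h.measurePreserving m) f :=
  continuous_orbit_of_aestronglyMeasurable ν
    (U := fun m f => compEnd ℝ 2 (h.measurePreserving m) f)
    (fun m v w => by
      rw [← map_sub]
      exact Lp.norm_compMeasurePreserving _ _)
    (fun m n v => by rw [h.compEnd_mul]; rfl)
    h.aestronglyMeasurable f

/-- Measurability is assumed on real `L²` only; real and imaginary parts reduce the general case to
it. -/
theorem continuous_compEnd [IsTopologicalGroup Γ] [LocallyCompactSpace Γ] [T2Space Γ]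
    [BorelSpace Γ] [ν.IsHaarMeasure] [ν.Regular] {τ : Γ → X → X}
    (h : IsMeasurePreservingAction ν μ τ) {𝕜 : Type*} [RCLike 𝕜] (f : Lp 𝕜 2 μ) :
    Continuous fun m => compEnd 𝕜 2 (h.measurePreserving m) f := by
  set R : Lp ℝ 2 μ := (RCLike.reCLM : 𝕜 →L[ℝ] ℝ).compLp f
  set I : Lp ℝ 2 μ := (RCLike.imCLM : 𝕜 →L[ℝ] ℝ).compLp f
  set A : Lp ℝ 2 μ →L[ℝ] Lp 𝕜 2 μ := (RCLike.ofRealCLM : ℝ →L[ℝ] 𝕜).compLpL 2 μ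
  have hf : f = A R + (RCLike.I : 𝕜) • A I := by
    refine Lp.ext ?_
    filter_upwards [Lp.coeFn_add (A R) ((RCLike.I : 𝕜) • A I),
      Lp.coeFn_smul (RCLike.I : 𝕜) (A I),
      (RCLike.ofRealCLM : ℝ →L[ℝ] 𝕜).coeFn_compLpL R,
      (RCLike.ofRealCLM : ℝ →L[ℝ] 𝕜).coeFn_compLpL I,
      (RCLike.reCLM : 𝕜 →L[ℝ] ℝ).coeFn_compLp f,
      (RCLike.imCLM : 𝕜 →L[ℝ] ℝ).coeFn_compLp f] with x h1 h2 h3 h4 h5 h6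
    rw [h1, Pi.add_apply, h2, Pi.smul_apply, h3, h4, h5, h6]
    simp only [RCLike.ofRealCLM_apply, RCLike.reCLM_apply, RCLike.imCLM_apply, smul_eq_mul]
    rw [mul_comm, RCLike.re_add_im]
  have hA : ∀ m (g : Lp ℝ 2 μ), compEnd 𝕜 2 (h.measurePreserving m) (A g) =
      A (compEnd ℝ 2 (h.measurePreserving m) g) := fun m g => by
    rcases g with ⟨⟨g⟩, hg⟩
    rfl
  have hsmul : ∀ m (g : Lp 𝕜 2 μ), compEnd 𝕜 2 (h.measurePreserving m) ((RCLike.I : 𝕜) • g) =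
      (RCLike.I : 𝕜) • compEnd 𝕜 2 (h.measurePreserving m) g := fun m g =>
    map_smul (Lp.compMeasurePreservingₗ 𝕜 _ (h.measurePreserving m)) _ g
  have e : (fun m => compEnd 𝕜 2 (h.measurePreserving m) f) = fun m =>
      A (compEnd ℝ 2 (h.measurePreserving m) R) +
        (RCLike.I : 𝕜) • A (compEnd ℝ 2 (h.measurePreserving m) I) := by
    ext1 m
    conv_lhs => rw [hf]
    rw [map_add, hsmul, hA, hA]
  rw [e]
  have hI : Continuous fun m => A (compEnd ℝ 2 (h.measurePreserving m) I) :=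
    A.continuous.comp (h.continuous_compEnd_real I)
  exact (A.continuous.comp (h.continuous_compEnd_real R)).add ((continuous_const_smul _).comp hI)

end IsMeasurePreservingAction

end CompositionOperators

/-! ### `L^∞` as a multiplicative monoid acting on `L²`. -/

section Linfty

set_option linter.unusedSectionVars false

open scoped InnerProductSpace

variable {X 𝕜 : Type*} [RCLike 𝕜] [MeasurableSpace X] {μ : Measure X}

theorem ae_norm_le_norm_linfty (a : Lp 𝕜 ∞ μ) : ∀ᵐ x ∂μ, ‖a x‖ ≤ ‖a‖ := by
  filter_upwards [ae_le_eLpNormEssSup (f := a) (μ := μ)] with x hx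
  rw [Lp.norm_def, eLpNorm_exponent_top, ← toReal_enorm]
  refine ENNReal.toReal_mono ?_ hx
  rw [← eLpNorm_exponent_top]
  exact Lp.eLpNorm_ne_top a

theorem norm_linfty_le [IsProbabilityMeasure μ] {a : Lp 𝕜 ∞ μ} {C : ℝ} (hC : 0 ≤ C)
    (h : ∀ᵐ x ∂μ, ‖a x‖ ≤ C) : ‖a‖ ≤ C := by
  simpa using Lp.norm_le_of_ae_bound hC h

/-- Multiplication of an essentially bounded function with an `L^p` function. -/
noncomputable def mulLp (p : ℝ≥0∞) [Fact (1 ≤ p)] :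
    Lp 𝕜 ∞ μ →L[ℝ] Lp 𝕜 p μ →L[ℝ] Lp 𝕜 p μ :=
  (ContinuousLinearMap.mul ℝ 𝕜).holderL μ ∞ p p

theorem coeFn_mulLp {p : ℝ≥0∞} [Fact (1 ≤ p)] (a : Lp 𝕜 ∞ μ) (v : Lp 𝕜 p μ) :
    mulLp p a v =ᵐ[μ] fun x => a x * v x :=
  (ContinuousLinearMap.mul ℝ 𝕜).coeFn_holder a v

theorem norm_mulLp_le {p : ℝ≥0∞} [Fact (1 ≤ p)] (a : Lp 𝕜 ∞ μ) (v : Lp 𝕜 p μ) :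
    ‖mulLp p a v‖ ≤ ‖a‖ * ‖v‖ := by
  refine ((ContinuousLinearMap.mul ℝ 𝕜).norm_holder_apply_apply_le a v).trans ?_
  have := ContinuousLinearMap.opNorm_mul_le ℝ 𝕜
  calc ‖ContinuousLinearMap.mul ℝ 𝕜‖ * ‖a‖ * ‖v‖ ≤ 1 * ‖a‖ * ‖v‖ := by gcongr
    _ = ‖a‖ * ‖v‖ := by ring

variable [IsProbabilityMeasure μ]

theorem coeFn_const_one (p : ℝ≥0∞) : Lp.const p μ (1 : 𝕜) =ᵐ[μ] fun _ => 1 :=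
  Lp.coeFn_const _ _ _

noncomputable instance linftyCommMonoid : CommMonoid (Lp 𝕜 ∞ μ) where
  mul a b := mulLp ∞ a b
  one := Lp.const ∞ μ 1
  mul_assoc a b c := by
    refine Lp.ext ?_
    filter_upwards [coeFn_mulLp (mulLp ∞ a b) c, coeFn_mulLp a b, coeFn_mulLp a (mulLp ∞ b c),
      coeFn_mulLp b c] with x h1 h2 h3 h4
    refine h1.trans (Eq.trans ?_ h3.symm)
    rw [h2, h4, mul_assoc]
  one_mul a := by
    refine Lp.ext ?_
    filter_upwards [coeFn_mulLp (Lp.const ∞ μ (1 : 𝕜)) a, coeFn_const_one (𝕜 := 𝕜) (μ := μ) ∞] with x h1 h2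
    refine h1.trans ?_
    rw [h2, one_mul]
  mul_one a := by
    refine Lp.ext ?_
    filter_upwards [coeFn_mulLp a (Lp.const ∞ μ (1 : 𝕜)), coeFn_const_one (𝕜 := 𝕜) (μ := μ) ∞] with x h1 h2
    refine h1.trans ?_
    rw [h2, mul_one]
  mul_comm a b := by
    refine Lp.ext ?_
    filter_upwards [coeFn_mulLp a b, coeFn_mulLp b a] with x h1 h2
    refine h1.trans (Eq.trans ?_ h2.symm)
    rw [mul_comm]

theorem coeFn_linfty_mul (a b : Lp 𝕜 ∞ μ) : ⇑(a * b) =ᵐ[μ] fun x => a x * b x :=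
  coeFn_mulLp a b

theorem coeFn_linfty_one : ⇑(1 : Lp 𝕜 ∞ μ) =ᵐ[μ] fun _ => 1 := coeFn_const_one ∞

/-- The inclusion of `L^∞` in `L²`. -/
noncomputable def linftyToL2 : Lp 𝕜 ∞ μ →ₗ[ℝ] Lp 𝕜 2 μ :=
  ((mulLp 2).flip (Lp.const 2 μ 1)).toLinearMap

theorem coeFn_linftyToL2 (a : Lp 𝕜 ∞ μ) : linftyToL2 a =ᵐ[μ] a := by
  filter_upwards [coeFn_mulLp a (Lp.const 2 μ (1 : 𝕜)), coeFn_const_one (𝕜 := 𝕜) (μ := μ) 2] with x h1 h2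
  refine h1.trans ?_
  rw [h2, mul_one]

theorem norm_linftyToL2_le (a : Lp 𝕜 ∞ μ) : ‖linftyToL2 a‖ ≤ ‖a‖ := by
  have h : ∀ᵐ x ∂μ, ‖linftyToL2 a x‖ ≤ ‖a‖ := by
    filter_upwards [coeFn_linftyToL2 a, ae_norm_le_norm_linfty a] with x h1 h2
    rwa [h1]
  have h1 : measureUnivNNReal μ = 1 := by simp [measureUnivNNReal]
  simpa [h1] using Lp.norm_le_of_ae_bound (norm_nonneg a) h

/-- A sequence convergent in `L²` has a subsequence convergent almost everywhere, and pointwise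
bounds survive that limit. -/
theorem isClosed_linftyToL2_image_closedBall (C : ℝ) :
    IsClosed ((linftyToL2 : Lp 𝕜 ∞ μ →ₗ[ℝ] Lp 𝕜 2 μ) '' Metric.closedBall 0 C) := by
  refine isSeqClosed_iff_isClosed.1 fun u v hu huv => ?_
  have hC : 0 ≤ C := by
    obtain ⟨a, ha, -⟩ := hu 0
    exact (norm_nonneg a).trans (by simpa using ha)
  obtain ⟨ns, -, hns⟩ := (tendstoInMeasure_of_tendsto_Lp huv).exists_seq_tendsto_ae
  have hub : ∀ᵐ x ∂μ, ∀ i, ‖u i x‖ ≤ C := by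
    rw [ae_all_iff]
    intro i
    obtain ⟨a, ha, hai⟩ := hu i
    filter_upwards [coeFn_linftyToL2 a, ae_norm_le_norm_linfty a] with x h1 h2
    rw [← hai, h1]
    exact h2.trans (by simpa using ha)
  have hv : ∀ᵐ x ∂μ, ‖v x‖ ≤ C := by
    filter_upwards [hns, hub] with x h1 h2
    exact le_of_tendsto' h1.norm fun i => h2 _
  have hmem : MemLp v ∞ μ := memLp_top_of_bound (Lp.aestronglyMeasurable v) C hv
  refine ⟨hmem.toLp, ?_, ?_⟩
  · rw [mem_closedBall_zero_iff]
    refine norm_linfty_le hC ?_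
    filter_upwards [hmem.coeFn_toLp, hv] with x h1 h2
    rwa [h1]
  · refine Lp.ext ?_
    filter_upwards [coeFn_linftyToL2 hmem.toLp, hmem.coeFn_toLp] with x h1 h2
    rw [h1, h2]

theorem coeFn_compEnd {p : ℝ≥0∞} {T : X → X} (hT : MeasurePreserving T μ μ) (f : Lp 𝕜 p μ) :
    compEnd 𝕜 p hT f =ᵐ[μ] f ∘ T :=
  Lp.coeFn_compMeasurePreserving f hT

theorem ae_comp {T : X → X} (hT : MeasurePreserving T μ μ) {q : X → Prop}
    (h : ∀ᵐ x ∂μ, q x) : ∀ᵐ x ∂μ, q (T x) :=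
  hT.quasiMeasurePreserving.ae h

/-- Composition with a measure-preserving map on `L^∞` as a monoid homomorphism. -/
noncomputable def compLinfty {T : X → X} (hT : MeasurePreserving T μ μ) :
    Lp 𝕜 ∞ μ →* Lp 𝕜 ∞ μ where
  toFun := compEnd 𝕜 ∞ hT
  map_one' := by
    refine Lp.ext ?_
    filter_upwards [coeFn_compEnd hT (1 : Lp 𝕜 ∞ μ), coeFn_linfty_one (μ := μ) (𝕜 := 𝕜),
      ae_comp hT (coeFn_linfty_one (μ := μ) (𝕜 := 𝕜))] with x h1 h2 h3
    rw [h1, h2, Function.comp_apply, h3]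
  map_mul' a b := by
    refine Lp.ext ?_
    filter_upwards [coeFn_compEnd hT (a * b), ae_comp hT (coeFn_linfty_mul a b),
      coeFn_linfty_mul (compEnd 𝕜 ∞ hT a) (compEnd 𝕜 ∞ hT b), coeFn_compEnd hT a,
      coeFn_compEnd hT b] with x h1 h2 h3 h4 h5
    rw [h1, Function.comp_apply, h2, h3, h4, h5, Function.comp_apply, Function.comp_apply]

/-- Complex conjugation on `L^∞`. -/
noncomputable def conjLinfty : Lp 𝕜 ∞ μ →* Lp 𝕜 ∞ μ where
  toFun a := star a
  map_one' := by
    refine Lp.ext ?_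
    filter_upwards [Lp.coeFn_star (1 : Lp 𝕜 ∞ μ), coeFn_linfty_one (μ := μ) (𝕜 := 𝕜)]
      with x h1 h2
    rw [h1, Pi.star_apply, h2, star_one]
  map_mul' a b := by
    refine Lp.ext ?_
    filter_upwards [Lp.coeFn_star (a * b), coeFn_linfty_mul a b, coeFn_linfty_mul (star a) (star b),
      Lp.coeFn_star a, Lp.coeFn_star b] with x h1 h2 h3 h4 h5
    rw [h1, Pi.star_apply, h2, h3, h4, h5, star_mul', Pi.star_apply, Pi.star_apply]

theorem coeFn_conjLinfty (a : Lp 𝕜 ∞ μ) : conjLinfty a =ᵐ[μ] fun x => star (a x) :=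
  Lp.coeFn_star a

/-- Composition with a measure-preserving map on `L²`. -/
noncomputable def compL2 {T : X → X} (hT : MeasurePreserving T μ μ) :
    Lp 𝕜 2 μ →ₗᵢ[ℝ] Lp 𝕜 2 μ :=
  Lp.compMeasurePreservingₗᵢ ℝ T hT

end Linfty

/-! ### Compositions along a sequence of actions. -/

section Sequences

set_option linter.unusedSectionVars false

/-- `seqComp T k` is `T 0 ∘ ⋯ ∘ T (k - 1)`. -/
def seqComp {X : Type*} (T : ℕ → X → X) : ℕ → X → X
  | 0 => id
  | k + 1 => seqComp T k ∘ T k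

variable {X : Type*} [MeasurableSpace X] {μ : Measure X}

theorem measurePreserving_seqComp {T : ℕ → X → X} (hT : ∀ k, MeasurePreserving (T k) μ μ)
    (k : ℕ) : MeasurePreserving (seqComp T k) μ μ := by
  induction k with
  | zero => exact MeasurePreserving.id μ
  | succ k ih => exact ih.comp (hT k)

variable {Γ E : Type*} [Group Γ] [TopologicalSpace Γ] [MeasurableSpace Γ] {ν : Measure Γ}
  [NormedAddCommGroup E] {τ : ℕ → Γ → X → X}

theorem compEnd_seqComp (hτ : ∀ k m, MeasurePreserving (τ k m) μ μ) (p : ℝ≥0∞) (k : ℕ) (m : Γ) :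
    compEnd E p (measurePreserving_seqComp (fun k => hτ k m) k) =
      partialProd (fun k m => compEnd E p (hτ k m)) k m := by
  induction k with
  | zero => exact compEnd_id
  | succ k ih =>
    rw [partialProd, ← ih]
    exact compEnd_comp (measurePreserving_seqComp (fun k => hτ k m) k) (hτ k m)

theorem continuous_compEnd_seqComp [IsTopologicalGroup Γ] [LocallyCompactSpace Γ] [T2Space Γ]
    [BorelSpace Γ] [ν.IsHaarMeasure] [ν.Regular] {𝕜 : Type*} [RCLike 𝕜]
    (hτ : ∀ k, IsMeasurePreservingAction ν μ (τ k)) (k : ℕ) (f : Lp 𝕜 2 μ) :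
    Continuous fun m => compEnd 𝕜 2
      (measurePreserving_seqComp (fun k => (hτ k).measurePreserving m) k) f := by
  induction k with
  | zero =>
    change Continuous fun _ : Γ => compEnd 𝕜 2 (MeasurePreserving.id μ) f
    exact continuous_const
  | succ k ih =>
    have e : ∀ m, compEnd 𝕜 2 (measurePreserving_seqComp
        (fun k => (hτ k).measurePreserving m) (k + 1)) f =
        compEnd 𝕜 2 ((hτ k).measurePreserving m) (compEnd 𝕜 2 (measurePreserving_seqComp
          (fun k => (hτ k).measurePreserving m) k) f) := fun m => by
      have := compEnd_comp (E := 𝕜) (p := 2) (measurePreserving_seqComp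
        (fun k => (hτ k).measurePreserving m) k) ((hτ k).measurePreserving m)
      exact DFunLike.congr_fun this f
    simp only [e]
    set w : Γ → Lp 𝕜 2 μ := fun m => compEnd 𝕜 2 (measurePreserving_seqComp
          (fun k => (hτ k).measurePreserving m) k) f
    rw [continuous_iff_continuousAt]
    intro m₀
    rw [ContinuousAt, tendsto_iff_norm_sub_tendsto_zero]
    have h1 : Tendsto (fun m => ‖w m - w m₀‖ +
        ‖compEnd 𝕜 2 ((hτ k).measurePreserving m) (w m₀) -
          compEnd 𝕜 2 ((hτ k).measurePreserving m₀) (w m₀)‖) (𝓝 m₀) (𝓝 (0 + 0)) :=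
      (tendsto_iff_norm_sub_tendsto_zero.1 ih.continuousAt).add
        (tendsto_iff_norm_sub_tendsto_zero.1 ((hτ k).continuous_compEnd (w m₀)).continuousAt)
    rw [add_zero] at h1
    refine squeeze_zero (fun _ => norm_nonneg _) (fun m => ?_) h1
    have e2 : ‖w m - w m₀‖ = ‖compEnd 𝕜 2 ((hτ k).measurePreserving m) (w m - w m₀)‖ :=
      (Lp.norm_compMeasurePreserving _ _).symm
    rw [e2, map_sub]
    refine (le_of_eq ?_).trans (norm_add_le _ _)
    congr 1
    abel

end Sequences

/-! ### The system of commuting actions. -/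

section System

set_option linter.unusedSectionVars false

open scoped InnerProductSpace

variable {Γ X 𝕜 : Type*} [Group Γ] [TopologicalSpace Γ] [IsTopologicalGroup Γ]
  [LocallyCompactSpace Γ] [T2Space Γ] [MeasurableSpace Γ] [BorelSpace Γ]
  {ν : Measure Γ} [ν.IsHaarMeasure] [ν.Regular]
  [MeasurableSpace X] {μ : Measure X} [IsProbabilityMeasure μ] [RCLike 𝕜]
  {τ : ℕ → Γ → X → X}

theorem compEnd_commute_of_ae {p : ℝ≥0∞} (hτ : ∀ k, IsMeasurePreservingAction ν μ (τ k))
    (hcomm : ∀ i k, i ≠ k → ∀ m n, τ i m ∘ τ k n =ᵐ[μ] τ k n ∘ τ i m) (i k : ℕ) (hik : i ≠ k)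
    (m n : Γ) : compEnd 𝕜 p ((hτ i).measurePreserving m) * compEnd 𝕜 p ((hτ k).measurePreserving n)
      = compEnd 𝕜 p ((hτ k).measurePreserving n) * compEnd 𝕜 p ((hτ i).measurePreserving m) := by
  rw [← compEnd_comp, ← compEnd_comp]
  exact compEnd_congr _ _ (hcomm k i hik.symm n m)

/-- The system attached to the products `τ_0 ⋯ τ_k` of commuting measure-preserving actions. -/
noncomputable def commutingSystem (𝕜 : Type*) [RCLike 𝕜]
    (hτ : ∀ k, IsMeasurePreservingAction ν μ (τ k))
    (hcomm : ∀ i k, i ≠ k → ∀ m n, τ i m ∘ τ k n =ᵐ[μ] τ k n ∘ τ i m) (j : ℕ) :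
    MultSystem Γ (Lp 𝕜 ∞ μ) (Lp 𝕜 2 μ) j where
  emb := linftyToL2
  mul := mulLp 2
  conj := conjLinfty
  act k m := compLinfty (measurePreserving_seqComp (fun k => (hτ k).measurePreserving m) (k + 1))
  opAct k m :=
    (compL2 (measurePreserving_seqComp (fun k => (hτ k).measurePreserving m) (k + 1)))
      |>.toContinuousLinearMap
  norm_mul_le := norm_mulLp_le
  norm_one_le := norm_linfty_le zero_le_one (by
    filter_upwards [coeFn_linfty_one (μ := μ) (𝕜 := 𝕜)] with x hx
    simp [hx])
  norm_conj_le a := norm_linfty_le (norm_nonneg a) (by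
    filter_upwards [coeFn_conjLinfty a, ae_norm_le_norm_linfty a] with x h1 h2
    rwa [h1, norm_star])
  norm_act_le k m a := (Lp.norm_compMeasurePreserving _ _).le
  norm_opAct_le k m v := (Lp.norm_compMeasurePreserving _ _).le
  norm_emb_le := norm_linftyToL2_le
  norm_mul_apply_le := norm_mulLp_le
  mul_emb a b := by
    refine Lp.ext ?_
    filter_upwards [coeFn_mulLp a (linftyToL2 b), coeFn_linftyToL2 b, coeFn_linftyToL2 (a * b),
      coeFn_linfty_mul a b] with x h1 h2 h3 h4
    rw [h1, h2, h3, h4]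
  opAct_emb k m a := by
    set hT := measurePreserving_seqComp (fun k => (hτ k).measurePreserving m) (k + 1)
    refine Lp.ext ?_
    filter_upwards [coeFn_compEnd hT (linftyToL2 a), ae_comp hT (coeFn_linftyToL2 a),
      coeFn_linftyToL2 (compLinfty hT a), coeFn_compEnd hT a] with x h1 h2 h3 h4
    exact h1.trans (h2.trans (h4.symm.trans h3.symm))
  inner_mul a v w := by
    rw [L2.inner_def, L2.inner_def]
    refine integral_congr_ae ?_
    filter_upwards [coeFn_mulLp a v, coeFn_mulLp (conjLinfty a) w, coeFn_conjLinfty a]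
      with x h1 h2 h3
    rw [h1, h2, h3]
    simp only [real_inner_eq_re_inner 𝕜, RCLike.inner_apply, map_mul, RCLike.star_def]
    ring_nf
  conj_act k m a := by
    set hT := measurePreserving_seqComp (fun k => (hτ k).measurePreserving m) (k + 1)
    refine Lp.ext ?_
    filter_upwards [coeFn_conjLinfty (compLinfty hT a), coeFn_compEnd hT a,
      coeFn_compEnd hT (conjLinfty a), ae_comp hT (coeFn_conjLinfty a)] with x h1 h2 h3 h4
    refine h1.trans (Eq.trans ?_ (h4.symm.trans h3.symm))
    exact congrArg star h2
  isClosed_image_closedBall := isClosed_linftyToL2_image_closedBall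
  inner_opAct k _ m v w := by
    set hT := measurePreserving_seqComp (fun k => (hτ k).measurePreserving m) (k + 1)
    set hT' := measurePreserving_seqComp (fun k => (hτ k).measurePreserving m⁻¹) (k + 1)
    -- An isometry with a right inverse has that inverse as its adjoint.
    have h : compL2 hT (compL2 hT' w) = w := by
      have h1 := compEnd_seqComp (E := 𝕜) (fun k => (hτ k).measurePreserving) 2 (k + 1) m
      have h2 := compEnd_seqComp (E := 𝕜) (fun k => (hτ k).measurePreserving) 2 (k + 1) m⁻¹
      have h3 := partialProd_mul (fun k => (hτ k).compEnd_mul (E := 𝕜) 2)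
        (compEnd_commute_of_ae hτ hcomm) (k + 1) m⁻¹ m
      rw [inv_mul_cancel, partialProd_one (fun k => (hτ k).compEnd_one 2), ← h1, ← h2] at h3
      exact (DFunLike.congr_fun h3 w).symm
    calc ⟪compL2 hT v, w⟫_ℝ = ⟪compL2 hT v, compL2 hT (compL2 hT' w)⟫_ℝ := by rw [h]
      _ = ⟪v, compL2 hT' w⟫_ℝ := LinearIsometry.inner_map_map _ _ _
  act_mul k _ m n a := by
    have h3 := partialProd_mul (fun k => (hτ k).compEnd_mul (E := 𝕜) ∞)
      (compEnd_commute_of_ae hτ hcomm) (k + 1) m n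
    simp only [← compEnd_seqComp (E := 𝕜) (fun k => (hτ k).measurePreserving) ∞] at h3
    exact DFunLike.congr_fun h3 a
  act_comm k _ i hik m l a := by
    have h3 := partialProd_comm (fun k => (hτ k).compEnd_one (E := 𝕜) ∞)
      (fun k => (hτ k).compEnd_mul (E := 𝕜) ∞) (compEnd_commute_of_ae hτ hcomm)
      (Nat.succ_le_succ hik.le) m l
    simp only [← compEnd_seqComp (E := 𝕜) (fun k => (hτ k).measurePreserving) ∞] at h3
    exact DFunLike.congr_fun h3 a
  continuous_opAct k _ v := continuous_compEnd_seqComp hτ (k + 1) v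

end System

/-! ### From finitely many actions to a sequence. -/

section Extension

set_option linter.unusedSectionVars false

variable {Γ X : Type*} {j : ℕ}

/-- Extend a finite family of actions by trivial actions. -/
def extendActions (τ : Fin j → Γ → X → X) (k : ℕ) (m : Γ) : X → X :=
  if h : k < j then τ ⟨k, h⟩ m else id

theorem seqComp_extendActions (τ : Fin j → Γ → X → X) (m : Γ) (i : Fin (j + 1)) :
    seqComp (fun k => extendActions τ k m) i = partialComp (fun k => τ k m) i := by
  induction i using Fin.induction with
  | zero => rfl
  | succ k ih =>
    have e : partialComp (fun k => τ k m) k.succ =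
      partialComp (fun k => τ k m) k.castSucc ∘ τ k m := rfl
    rw [e, ← ih, Fin.val_succ, seqComp]
    simp [extendActions]

variable [Group Γ] [TopologicalSpace Γ] [MeasurableSpace Γ] [MeasurableSpace X] {ν : Measure Γ}
  {μ : Measure X}

theorem isMeasurePreservingAction_id : IsMeasurePreservingAction ν μ fun (_ : Γ) => (id : X → X)
    where
  measurePreserving _ := MeasurePreserving.id μ
  map_one := Filter.EventuallyEq.rfl
  map_mul _ _ := Filter.EventuallyEq.rfl
  aestronglyMeasurable _ _ _ := aestronglyMeasurable_const

theorem isMeasurePreservingAction_extendActions {τ : Fin j → Γ → X → X}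
    (hτ : ∀ k, IsMeasurePreservingAction ν μ (τ k)) (k : ℕ) :
    IsMeasurePreservingAction ν μ (extendActions τ k) := by
  by_cases h : k < j
  · have e : extendActions τ k = τ ⟨k, h⟩ := by ext1 m; simp [extendActions, h]
    rw [e]
    exact hτ _
  · have e : extendActions τ k = fun _ => id := by ext1 m; simp [extendActions, h]
    rw [e]
    exact isMeasurePreservingAction_id

theorem extendActions_comm {τ : Fin j → Γ → X → X}
    (hcomm : ∀ i k, i ≠ k → ∀ m n, τ i m ∘ τ k n =ᵐ[μ] τ k n ∘ τ i m) (i k : ℕ) (hik : i ≠ k)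
    (m n : Γ) : extendActions τ i m ∘ extendActions τ k n =ᵐ[μ]
      extendActions τ k n ∘ extendActions τ i m := by
  by_cases hi : i < j
  · by_cases hk : k < j
    · simpa [extendActions, hi, hk] using hcomm ⟨i, hi⟩ ⟨k, hk⟩ (by simpa using hik) m n
    · simp [extendActions, hk]
  · simp [extendActions, hi]

end Extension

theorem coeFn_linfty_prod {X 𝕜 ι : Type*} [RCLike 𝕜] [MeasurableSpace X] {μ : Measure X}
    [IsProbabilityMeasure μ] (s : Finset ι) (a : ι → Lp 𝕜 ∞ μ) :
    ⇑(∏ i ∈ s, a i) =ᵐ[μ] fun x => ∏ i ∈ s, a i x := by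
  classical
  induction s using Finset.induction_on with
  | empty => simpa using coeFn_linfty_one
  | insert i s hi ih =>
    filter_upwards [coeFn_linfty_mul (a i) (∏ i ∈ s, a i), ih] with x h1 h2
    rw [Finset.prod_insert hi, h1, h2, Finset.prod_insert hi]

/-! ### Translation of the concrete averages and conclusion. -/

section Main

variable {Γ X 𝕜 : Type*} [Group Γ] [TopologicalSpace Γ] [IsTopologicalGroup Γ]
  [LocallyCompactSpace Γ] [T2Space Γ] [MeasurableSpace Γ] [BorelSpace Γ]
  {ν : Measure Γ} [ν.IsHaarMeasure] [ν.Regular]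
  [MeasurableSpace X] {μ : Measure X} [IsProbabilityMeasure μ] [RCLike 𝕜] {j : ℕ}
  {τ : Fin j → Γ → X → X}

/-- The elements of `L^∞` given by the functions `f₁, …, f_j`. -/
noncomputable def shiftedFunctions {f : Fin (j + 1) → X → 𝕜} (hf : ∀ i, MemLp (f i) ∞ μ) (i : ℕ) :
    Lp 𝕜 ∞ μ :=
  if h : i < j then (hf (Fin.succ ⟨i, h⟩)).toLp else 1

theorem multipleProduct_eq (hτ : ∀ k, IsMeasurePreservingAction ν μ (τ k))
    (hcomm : ∀ i k, i ≠ k → ∀ m n, τ i m ∘ τ k n =ᵐ[μ] τ k n ∘ τ i m)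
    {f : Fin (j + 1) → X → 𝕜} (hf : ∀ i, MemLp (f i) ∞ μ) (m : Γ) :
    multipleProduct (fun k => (hτ k).measurePreserving) hf m =
      mulLp 2 ((hf 0).toLp) (linftyToL2 ((commutingSystem 𝕜
        (isMeasurePreservingAction_extendActions hτ) (extendActions_comm hcomm) j).prodAct j m
          (shiftedFunctions hf))) := by
  set S := commutingSystem 𝕜 (isMeasurePreservingAction_extendActions hτ)
    (extendActions_comm hcomm) j
  have hfac : ∀ i : Fin j, S.act i m (shiftedFunctions hf i) =ᵐ[μ]
      fun x => f i.succ (partialComp (fun k => τ k m) i.succ x) := by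
    intro i
    have hT := measurePreserving_seqComp
      (fun k => (isMeasurePreservingAction_extendActions hτ k).measurePreserving m) (i + 1)
    have e : shiftedFunctions hf i = (hf i.succ).toLp := by simp [shiftedFunctions]
    filter_upwards [coeFn_compEnd hT (shiftedFunctions hf i), ae_comp hT (hf i.succ).coeFn_toLp]
      with x h1 h2
    refine h1.trans ?_
    rw [Function.comp_apply, e, h2]
    exact congrArg (fun g => f i.succ (g x)) (seqComp_extendActions τ m i.succ)
  refine Lp.ext ?_
  filter_upwards [(memLp_two_prod_partialComp (fun k => (hτ k).measurePreserving m) hf).coeFn_toLp,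
    coeFn_mulLp ((hf 0).toLp) (linftyToL2 (S.prodAct j m (shiftedFunctions hf))),
    (hf 0).coeFn_toLp, coeFn_linftyToL2 (S.prodAct j m (shiftedFunctions hf)),
    coeFn_linfty_prod (Finset.range j) (fun i => S.act i m (shiftedFunctions hf i)),
    ae_all_iff.2 hfac] with x h1 h2 h3 h4 h5 h6
  rw [h2, h3, h4]
  refine h1.trans ?_
  rw [Fin.prod_univ_succ]
  refine congrArg (f 0 x * ·) ?_
  refine Eq.trans ?_ h5.symm
  rw [Finset.prod_range]
  exact Finset.prod_congr rfl fun i _ => (h6 i).symm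

end Main

theorem theorem2 {Γ : Type*} [Group Γ] [TopologicalSpace Γ] [IsTopologicalGroup Γ]
    [LocallyCompactSpace Γ] [T2Space Γ] [MeasurableSpace Γ] [BorelSpace Γ]
    (ν : Measure Γ) [ν.IsHaarMeasure] [ν.Regular]
    {X : Type*} [MeasurableSpace X] (μ : Measure X) [IsProbabilityMeasure μ]
    {𝕜 : Type*} [RCLike 𝕜] (j : ℕ) (τ : Fin j → Γ → X → X)
    (hτ : ∀ k, IsMeasurePreservingAction ν μ (τ k))
    (hcomm : ∀ i k, i ≠ k → ∀ m n, τ i m ∘ τ k n =ᵐ[μ] τ k n ∘ τ i m)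
    (f : Fin (j + 1) → X → 𝕜) (hf : ∀ i, MemLp (f i) ∞ μ) :
    ∃ L : Lp 𝕜 2 μ, ∀ (A : Type*) [Preorder A] [IsDirectedOrder A] [Nonempty A]
      (F : A → Set Γ), IsFolnerNet ν F →
        (∀ α, IntegrableOn (multipleProduct (fun k => (hτ k).measurePreserving) hf) (F α) ν) ∧
        Tendsto (fun α => multipleAverage ν (fun k => (hτ k).measurePreserving) hf (F α))
          atTop (𝓝 L) := by
  set S := commutingSystem 𝕜 (isMeasurePreservingAction_extendActions hτ)
    (extendActions_comm hcomm) j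
  set g := shiftedFunctions hf
  have hgood : S.Good fun m => S.prodAct j m g :=
    MultSystem.good_prodAct (f := fun _ => g) le_rfl (fun i _ => MultSystem.good_const (g i))
      continuous_id
  have heq : multipleProduct (fun k => (hτ k).measurePreserving) hf =
      fun m => mulLp 2 ((hf 0).toLp) (S.emb (S.prodAct j m g)) :=
    funext (multipleProduct_eq hτ hcomm hf)
  have hcont : Continuous (multipleProduct (fun k => (hτ k).measurePreserving) hf) := by
    rw [heq]
    exact (mulLp 2 ((hf 0).toLp)).continuous.comp hgood.2
  obtain ⟨C, hC⟩ : ∃ C, ∀ i, ‖g i‖ ≤ C := by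
    refine ⟨∑ i ∈ Finset.range j, ‖g i‖ + ‖(1 : Lp 𝕜 ∞ μ)‖, fun i => ?_⟩
    by_cases h : i < j
    · exact (Finset.single_le_sum (f := fun i => ‖g i‖) (fun _ _ => norm_nonneg _)
        (Finset.mem_range.2 h)).trans (le_add_of_nonneg_right (norm_nonneg _))
    · have : g i = 1 := by simp [g, shiftedFunctions, h]
      rw [this]
      exact le_add_of_nonneg_left (Finset.sum_nonneg fun _ _ => norm_nonneg _)
  -- The limit is taken along the Følner filter before any net is introduced, which gives
  -- independence of the net.
  obtain ⟨L, hL⟩ := S.exists_tendsto_avg (ν := ν) g hC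
  refine ⟨mulLp 2 ((hf 0).toLp) L, fun A _ _ _ F hF =>
    ⟨fun α => hcont.continuousOn.integrableOn_compact (hF.isCompact α), ?_⟩⟩
  have h := ((mulLp 2 ((hf 0).toLp)).continuous.tendsto L).comp (hL.comp hF.tendsto_folnerFilter)
  refine h.congr fun α => ?_
  set E : AveragingSet ν := ⟨F α, hF.isCompact α, hF.measure_pos α⟩
  have h1 : multipleAverage ν (fun k => (hτ k).measurePreserving) hf (F α) =
      ∫ m, mulLp 2 ((hf 0).toLp) (S.emb (S.prodAct j m g)) ∂E.measure := by
    rw [E.integral_eq, multipleAverage, heq]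
  rw [h1, ContinuousLinearMap.integral_comp_comm _ (hgood.integrable E)]
  rfl
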